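/- Let $\Bbbk$ be an algebraically closed field of characteristic zero and $G$ a finite group. Let $\mathcal D(G)$ be the Drinfeld double of $G$ over $\Bbbk$: the Hopf algebra with basis $e_g\# h$ ($g,h\in G$), multiplication $(e_g\# x)(e_h\# y)=\delta_{g,xhx^{-1}}\,e_g\# xy$, unit $\sum_g e_g\#1$, comultiplication $\Delta(e_g\# h)=\sum_{ab=g}(e_b\# h)\otimes(e_a\# h)$ and counit $\varepsilon(e_g\# h)=\delta_{g,1}$. Let $\operatorname{Aut}(\mathcal D(G))$ be its group of Hopf algebra automorphisms. For $a=\sum_g a(g)e_g\in\Bbbk^G$ write $a\# h=\sum_g a(g)\,e_g\# h$. An automorphism $\psi$ has components $$u(a)=(\mathrm{id}\otimes\varepsilon)\psi(a\#1),\quad p(a)=(\mathrm{ev}_1\otimes\mathrm{id})\psi(a\#1),\quad r(g)=(\mathrm{id}\otimes\varepsilon)\psi(1\# g),\quad v(g)=(\mathrm{ev}_1\otimes\mathrm{id})\psi(1\# g),$$ where $(\mathrm{id}\otimes\varepsilon)(e_g\# h)=e_g\in\Bbbk^G$, $(\mathrm{ev}_1\otimes\mathrm{id})(e_g\# h)=\delta_{g,1}h\in\Bbbk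 G$, and the $1$ in $1\# g$ is the constant function $1$ on $G$. Let $\Lambda(G)$ be the subgroup of those $\psi\in\operatorname{Aut}(\mathcal D(G))$ for which $u=\mathrm{id}$, $r(g)=1$ and $v(g)=g$ for all $g\in G$; such a $\psi$ is written $(p,\mathrm{id},1,\mathrm{id})$. (1) Suppose that $G$ is perfect. Then $$\operatorname{Aut}(\mathcal D(G))\cong\Lambda(G)\rtimes\operatorname{Aut}(G),$$ where $v\in\operatorname{Aut}(G)$ acts by $v.(p,\mathrm{id},1,\mathrm{id})=(v\,p\,v^*,\mathrm{id},1,\mathrm{id})$ with $v^*(f)=f\circ v$ for $f\in\Bbbk^G$. The isomorphism can be chosen to be the inclusion on $\Lambda(G)$ and to send $v\in\operatorname{Aut}(G)$ to the automorphism $e_g\# h\mapsto e_{v(g)}\# v(h)$. Moreover, the center $Z(G)$ is isomorphic to its character group $\widehat{Z(G)}=\operatorname{Hom}(Z(G),\Bbbk^\times)$, and for every isomorphism $\theta\colon\widehat{Z(G)}\to Z(G)$ there is an $\operatorname{Aut}(G)$-equivariant group isomorphism $\Lambda(G)\cong\operatorname{End}(Z(G))$, where $\operatorname{End}(Z(G))$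 is a group under pointwise multiplication and $v\in\operatorname{Aut}(G)$ acts on it by $(v.f)(z)=v\bigl(f(\theta(\theta^{-1}(z)\circ v|_{Z(G)}))\bigr)$. Hence, for this action, $$\operatorname{Aut}(\mathcal D(G))\cong\Lambda(G)\rtimes\operatorname{Aut}(G)\cong\operatorname{End}(Z(G))\rtimes\operatorname{Aut}(G).$$ (2) For every finite group $G$, $\operatorname{Aut}(\mathcal D(G))\cong\operatorname{Aut}(G)$ if and only if $G$ is centerless and perfect. (3) In particular, $\operatorname{Aut}(\mathcal D(G))\cong\operatorname{Aut}(G)$ for every non-abelian finite simple group $G$. -/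

import Mathlib

open scoped TensorProduct
open scoped IsMulCommutative -- makes the center of a group a `CommGroup`

set_option linter.unusedSectionVars false

/-- The group of bialgebra automorphisms, under composition.  If the bialgebra is a Hopf algebra
this is its group of Hopf algebra automorphisms, since bialgebra maps preserve antipodes. -/
instance BialgEquiv.autGroup {R A : Type*} [CommSemiring R] [Semiring A] [Bialgebra R A] :
    Group (A ≃ₐc[R] A) where
  mul f g := g.trans f
  one := BialgEquiv.refl R A
  inv f := f.symm
  mul_assoc _ _ _ := rfl
  one_mul _ := rfl
  mul_one _ := rfl
  inv_mul_cancel f := by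
    apply BialgEquiv.ext
    intro x
    exact f.toEquiv.symm_apply_apply x

/-- The underlying space of the Drinfeld double `D(G) = k^G # kG` of a finite group `G`:
the element `∑ x (g, h) • (e_g # h)` is the function `x`. -/
def DrinfeldDouble (k G : Type*) : Type _ := G × G → k

namespace DrinfeldDouble

variable {k G : Type*} [Field k] [Group G] [Fintype G] [DecidableEq G]

instance : AddCommGroup (DrinfeldDouble k G) := inferInstanceAs (AddCommGroup (G × G → k))

instance : Module k (DrinfeldDouble k G) := inferInstanceAs (Module k (G × G → k))

theorem ext' {x y : DrinfeldDouble k G} (h : ∀ p, x p = y p) : x = y := funext h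

theorem add_app (x y : DrinfeldDouble k G) (p : G × G) : (x + y) p = x p + y p := rfl

theorem zero_app (p : G × G) : (0 : DrinfeldDouble k G) p = 0 := rfl

theorem smul_app (c : k) (x : DrinfeldDouble k G) (p : G × G) : (c • x) p = c * x p := rfl

/-- The simple tensor `a # h`, for `a ∈ k^G` and `h ∈ G`. -/
def smash (a : G → k) (h : G) : DrinfeldDouble k G := fun p => if p.2 = h then a p.1 else 0

/-- The basis element `e_g # h`. -/
def e (g h : G) : DrinfeldDouble k G := smash (Pi.single g 1) h

theorem smash_app (a : G → k) (h : G) (p : G × G) :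
    smash a h p = if p.2 = h then a p.1 else 0 := rfl

theorem e_app (g h : G) (p : G × G) :
    (e g h : DrinfeldDouble k G) p = if p.2 = h then (if p.1 = g then 1 else 0) else 0 := by
  simp [e, smash_app, Pi.single_apply]

/-- The elements `e_g # h` form a basis of `D(G)`. -/
noncomputable def basis : Module.Basis (G × G) k (DrinfeldDouble k G) := Pi.basisFun k (G × G)

theorem basis_app (p : G × G) : (basis p : DrinfeldDouble k G) = e p.1 p.2 := by
  apply ext'
  rintro ⟨x, y⟩
  have h : (basis p : DrinfeldDouble k G) = (Pi.single p (1 : k) : G × G → k) :=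
    Pi.basisFun_apply k (G × G) p
  rw [h, e_app]
  rcases p with ⟨g, h⟩
  simp only [Pi.single_apply, Prod.mk.injEq]
  split_ifs <;> simp_all

/-- Multiplication in coordinates; see `e_mul_e` for its values on the basis. -/
instance : Mul (DrinfeldDouble k G) where
  mul x y := fun p => ∑ s : G, x (p.1, s) * y (s⁻¹ * p.1 * s, s⁻¹ * p.2)

instance : One (DrinfeldDouble k G) where
  one := smash 1 1

theorem mul_app (x y : DrinfeldDouble k G) (p : G × G) :
    (x * y) p = ∑ s : G, x (p.1, s) * y (s⁻¹ * p.1 * s, s⁻¹ * p.2) := rfl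

theorem one_def : (1 : DrinfeldDouble k G) = smash 1 1 := rfl

/-- The defining formula `(e_g # x)(e_h # y) = δ_{g, x h x⁻¹} e_g # xy`. -/
theorem e_mul_e (g x h y : G) :
    (e g x : DrinfeldDouble k G) * e h y = if g = x * h * x⁻¹ then e g (x * y) else 0 := by
  apply ext'
  rintro ⟨a, b⟩
  rw [mul_app, Finset.sum_eq_single x]
  · by_cases hg : g = x * h * x⁻¹
    · subst hg
      simp only [e_app, if_true]
      by_cases ha : a = x * h * x⁻¹
      · subst ha
        simp [inv_mul_eq_iff_eq_mul, mul_assoc]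
      · simp [ha]
    · simp only [e_app, if_neg hg, zero_app, if_true]
      by_cases ha : a = g
      · subst ha
        have : ¬ (x⁻¹ * a * x = h) := by
          rintro rfl
          exact hg (by group)
        simp [this]
      · simp [ha]
  · intro s _ hs
    simp [e_app, hs]
  · simp

instance : Ring (DrinfeldDouble k G) where
  __ := (inferInstance : AddCommGroup (DrinfeldDouble k G))
  left_distrib x y z := by
    apply ext'; intro p
    simp only [mul_app, add_app, mul_add, Finset.sum_add_distrib]
  right_distrib x y z := by
    apply ext'; intro p
    simp only [mul_app, add_app, add_mul, Finset.sum_add_distrib]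
  zero_mul x := by
    apply ext'; intro p
    simp [mul_app, zero_app]
  mul_zero x := by
    apply ext'; intro p
    simp [mul_app, zero_app]
  mul_assoc x y z := by
    apply ext'; rintro ⟨g, c⟩
    simp only [mul_app, Finset.sum_mul, Finset.mul_sum]
    rw [Finset.sum_comm]
    refine Finset.sum_congr rfl fun s _ => ?_
    refine Fintype.sum_equiv (Equiv.mulLeft s⁻¹) _ _ fun t => ?_
    simp [mul_assoc]
  one_mul x := by
    apply ext'; rintro ⟨g, c⟩
    rw [mul_app, Finset.sum_eq_single 1]
    · simp [one_def, smash_app]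
    · intro s _ hs
      simp [one_def, smash_app, hs]
    · simp
  mul_one x := by
    apply ext'; rintro ⟨g, c⟩
    rw [mul_app, Finset.sum_eq_single c]
    · simp [one_def, smash_app]
    · intro s _ hs
      have : ¬ (s⁻¹ * c = 1) := by
        intro h
        exact hs (by rw [inv_mul_eq_one] at h; exact h)
      simp [one_def, smash_app, this]
    · simp

noncomputable instance : Algebra k (DrinfeldDouble k G) :=
  Algebra.ofModule
    (fun c x y => by
      apply ext'; intro p
      simp only [mul_app, smul_app, Finset.mul_sum, mul_assoc])
    (fun c x y => by
      apply ext'; intro p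
      simp only [mul_app, smul_app, Finset.mul_sum]
      exact Finset.sum_congr rfl fun s _ => by ring)

theorem smash_eq_sum (a : G → k) (h : G) : smash a h = ∑ g, a g • (e g h : DrinfeldDouble k G) := by
  have h1 := (basis (k := k) (G := G)).sum_repr (smash a h)
  rw [← h1, Fintype.sum_prod_type]
  refine Finset.sum_congr rfl fun g _ => ?_
  rw [Finset.sum_eq_single h]
  · rw [basis_app]
    congr 1
    change smash a h (g, h) = a g
    simp [smash_app]
  · intro b _ hb
    have : (basis.repr (smash a h)) (g, b) = (0 : k) := by
      change smash a h (g, b) = 0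
      simp [smash_app, hb]
    rw [this, zero_smul]
  · simp

theorem one_eq_sum : (1 : DrinfeldDouble k G) = ∑ g, e g 1 := by
  rw [one_def, smash_eq_sum]
  simp

/-- The coalgebra `(k^G)^cop ⊗ kG`: `Δ(e_g # h) = ∑_{ab = g} (e_b # h) ⊗ (e_a # h)` and
`ε(e_g # h) = δ_{g,1}`. -/
noncomputable instance : CoalgebraStruct k (DrinfeldDouble k G) where
  comul := basis.constr k fun p => ∑ a : G, e (a⁻¹ * p.1) p.2 ⊗ₜ[k] e a p.2
  counit := basis.constr k fun p => if p.1 = 1 then 1 else 0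

theorem comul_e (g h : G) : CoalgebraStruct.comul (R := k) (e g h : DrinfeldDouble k G) =
    ∑ a : G, (e (a⁻¹ * g) h : DrinfeldDouble k G) ⊗ₜ[k] (e a h : DrinfeldDouble k G) := by
  have := (basis (k := k) (G := G)).constr_basis k
    (fun p : G × G => ∑ a : G, (e (a⁻¹ * p.1) p.2 : DrinfeldDouble k G) ⊗ₜ[k]
      (e a p.2 : DrinfeldDouble k G)) (g, h)
  rwa [basis_app] at this

theorem counit_e (g h : G) : CoalgebraStruct.counit (R := k) (e g h : DrinfeldDouble k G) =
    if g = 1 then 1 else 0 := by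
  have := (basis (k := k) (G := G)).constr_basis k
    (fun p : G × G => if p.1 = 1 then (1 : k) else 0) (g, h)
  rwa [basis_app] at this

theorem hom_ext {M : Type*} [AddCommMonoid M] [Module k M] {f f' : DrinfeldDouble k G →ₗ[k] M}
    (h : ∀ g x, f (e g x) = f' (e g x)) : f = f' := by
  refine basis.ext fun p => ?_
  rw [basis_app]
  exact h _ _

noncomputable instance : Coalgebra k (DrinfeldDouble k G) where
  coassoc := by
    apply hom_ext
    intro g x
    simp only [LinearMap.comp_apply, comul_e, map_sum, LinearMap.rTensor_tmul,
      LinearMap.lTensor_tmul, TensorProduct.sum_tmul, TensorProduct.tmul_sum,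
      LinearEquiv.coe_coe, TensorProduct.assoc_tmul]
    -- both sides are `∑ (e_c # x) ⊗ (e_b # x) ⊗ (e_a # x)` over `a b c = g`
    rw [Finset.sum_comm (s := Finset.univ) (t := Finset.univ)
      (f := fun a b => (e (a⁻¹ * g) x : DrinfeldDouble k G) ⊗ₜ[k] (e (b⁻¹ * a) x ⊗ₜ[k] e b x))]
    refine Finset.sum_congr rfl fun a _ => ?_
    refine Fintype.sum_equiv (Equiv.mulLeft a) _ _ fun b => ?_
    simp [mul_assoc]
  rTensor_counit_comp_comul := by
    apply hom_ext
    intro g x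
    simp only [LinearMap.comp_apply, comul_e, map_sum, LinearMap.rTensor_tmul, counit_e]
    rw [Finset.sum_eq_single g]
    · simp
    · intro a _ ha
      have : ¬ (a⁻¹ * g = 1) := by rwa [inv_mul_eq_one]
      simp [this]
    · simp
  lTensor_counit_comp_comul := by
    apply hom_ext
    intro g x
    simp only [LinearMap.comp_apply, comul_e, map_sum, LinearMap.lTensor_tmul, counit_e]
    rw [Finset.sum_eq_single 1]
    · simp
    · intro a _ ha
      simp [ha]
    · simp

theorem bilin_ext {M : Type*} [AddCommMonoid M] [Module k M]
    {f f' : DrinfeldDouble k G →ₗ[k] DrinfeldDouble k G →ₗ[k] M}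
    (h : ∀ g x g' y, f (e g x) (e g' y) = f' (e g x) (e g' y)) : f = f' :=
  hom_ext fun g x => hom_ext fun g' y => h g x g' y

noncomputable instance : Bialgebra k (DrinfeldDouble k G) where
  counit_one := by
    rw [one_eq_sum, map_sum]
    simp [counit_e]
  mul_compr₂_counit := by
    apply bilin_ext
    intro g x h y
    simp only [LinearMap.compr₂_apply, LinearMap.mul_apply', LinearMap.compl₁₂_apply, counit_e,
      e_mul_e]
    by_cases hh : h = 1
    · subst hh
      by_cases hg : g = 1
      · simp [hg, counit_e]
      · simp [hg]
    · by_cases hg : g = 1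
      · subst hg
        have : ¬ (1 = x * h * x⁻¹) := by
          intro h'
          exact hh (by simpa using (conj_eq_one_iff.mp h'.symm))
        simp [hh, this]
      · split_ifs <;> simp [counit_e, hg]
  comul_one := by
    rw [one_eq_sum, map_sum, Algebra.TensorProduct.one_def, one_eq_sum]
    simp only [comul_e, TensorProduct.sum_tmul, TensorProduct.tmul_sum]
    rw [Finset.sum_comm]
    refine Finset.sum_congr rfl fun a _ => ?_
    exact Fintype.sum_equiv (Equiv.mulLeft a⁻¹) _ _ fun g => rfl
  mul_compr₂_comul := by
    apply bilin_ext
    intro g x h y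
    simp only [LinearMap.compr₂_apply, LinearMap.mul_apply', LinearMap.compl₁₂_apply, comul_e,
      Finset.sum_mul, Finset.mul_sum, Algebra.TensorProduct.tmul_mul_tmul, e_mul_e]
    have key : ∀ a b : G,
        ((if a⁻¹ * g = x * (b⁻¹ * h) * x⁻¹ then (e (a⁻¹ * g) (x * y) : DrinfeldDouble k G) else 0)
          ⊗ₜ[k] (if a = x * b * x⁻¹ then (e a (x * y) : DrinfeldDouble k G) else 0)) =
        if b = x⁻¹ * a * x then
          (if g = x * h * x⁻¹ then
            (e (a⁻¹ * g) (x * y) : DrinfeldDouble k G) ⊗ₜ[k] e a (x * y) else 0)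
        else 0 := by
      intro a b
      by_cases hb : b = x⁻¹ * a * x
      · subst hb
        have h1 : a = x * (x⁻¹ * a * x) * x⁻¹ := by group
        have h2 : (a⁻¹ * g = x * ((x⁻¹ * a * x)⁻¹ * h) * x⁻¹) ↔ g = x * h * x⁻¹ := by
          rw [inv_mul_eq_iff_eq_mul]
          simp [mul_assoc]
        rw [if_pos h1, if_pos rfl]
        by_cases hg : g = x * h * x⁻¹
        · rw [if_pos (h2.mpr hg), if_pos hg]
        · rw [if_neg (fun h => hg (h2.mp h)), if_neg hg, TensorProduct.zero_tmul]
      · have h1 : ¬ (a = x * b * x⁻¹) := by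
          rintro rfl
          exact hb (by group)
        rw [if_neg h1, if_neg hb, TensorProduct.tmul_zero]
    simp only [key]
    by_cases hg : g = x * h * x⁻¹
    · simp only [if_pos hg, comul_e]
      conv_rhs => rw [Finset.sum_comm]
      exact Finset.sum_congr rfl fun a _ => by simp
    · simp [hg]

/-- The antipode is `S(e_g # h) = e_{h⁻¹ g⁻¹ h} # h⁻¹`. -/
noncomputable instance : HopfAlgebraStruct k (DrinfeldDouble k G) where
  antipode := basis.constr k fun p => e (p.2⁻¹ * p.1⁻¹ * p.2) p.2⁻¹

theorem antipode_e (g h : G) : HopfAlgebraStruct.antipode k (e g h : DrinfeldDouble k G) =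
    e (h⁻¹ * g⁻¹ * h) h⁻¹ := by
  have := (basis (k := k) (G := G)).constr_basis k
    (fun p : G × G => (e (p.2⁻¹ * p.1⁻¹ * p.2) p.2⁻¹ : DrinfeldDouble k G)) (g, h)
  rwa [basis_app] at this

noncomputable instance : HopfAlgebra k (DrinfeldDouble k G) where
  mul_antipode_rTensor_comul := by
    apply hom_ext
    intro g x
    simp only [LinearMap.comp_apply, comul_e, map_sum, LinearMap.rTensor_tmul, antipode_e,
      LinearMap.mul'_apply, e_mul_e, counit_e, Algebra.linearMap_apply]
    by_cases hg : g = 1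
    · subst hg
      simp only [if_true, map_one, one_eq_sum]
      refine Fintype.sum_equiv ((MulAut.conj x⁻¹).toEquiv) _ _ fun a => ?_
      simp [mul_assoc]
    · have : ∀ a : G, ¬ (x⁻¹ * (a⁻¹ * g)⁻¹ * x = x⁻¹ * a * x⁻¹⁻¹) := by
        intro a h
        apply hg
        simpa [mul_assoc] using h
      simp [hg]
  mul_antipode_lTensor_comul := by
    apply hom_ext
    intro g x
    simp only [LinearMap.comp_apply, comul_e, map_sum, LinearMap.lTensor_tmul, antipode_e,
      LinearMap.mul'_apply, e_mul_e, counit_e, Algebra.linearMap_apply]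
    by_cases hg : g = 1
    · subst hg
      simp only [if_true, map_one, one_eq_sum]
      refine Fintype.sum_equiv (Equiv.inv G) _ _ fun a => ?_
      simp [mul_assoc]
    · have : ∀ a : G, ¬ (a⁻¹ * g = x * (x⁻¹ * a⁻¹ * x) * x⁻¹) := by
        intro a h
        apply hg
        simpa [mul_assoc] using h
      simp [hg, this]

/-- `id ⊗ ε : D(G) → k^G`, `e_g # h ↦ e_g`. -/
noncomputable def toDual : DrinfeldDouble k G →ₗ[k] (G → k) :=
  basis.constr k fun p => Pi.single p.1 1

/-- `ev_1 ⊗ id : D(G) → kG`, `e_g # h ↦ δ_{g,1} h`. -/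
noncomputable def toGrp : DrinfeldDouble k G →ₗ[k] MonoidAlgebra k G :=
  basis.constr k fun p => if p.1 = 1 then MonoidAlgebra.of k G p.2 else 0

/-- The linear map `k^G → D(G)`, `a ↦ a # h`. -/
def smashLin (h : G) : (G → k) →ₗ[k] DrinfeldDouble k G where
  toFun a := smash a h
  map_add' a b := by
    apply ext'; intro p
    simp only [smash_app, add_app, Pi.add_apply]
    split_ifs <;> simp
  map_smul' c a := by
    apply ext'; intro p
    simp [smash_app, smul_app]

/-- The component `u(a) = (id ⊗ ε)(ψ(a # 1))` of `ψ`. -/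
noncomputable def compU (ψ : DrinfeldDouble k G ≃ₐc[k] DrinfeldDouble k G) :
    (G → k) →ₗ[k] (G → k) :=
  toDual ∘ₗ (ψ : DrinfeldDouble k G →ₗ[k] DrinfeldDouble k G) ∘ₗ smashLin 1

/-- The component `p(a) = (ev_1 ⊗ id)(ψ(a # 1))` of `ψ`. -/
noncomputable def compP (ψ : DrinfeldDouble k G ≃ₐc[k] DrinfeldDouble k G) :
    (G → k) →ₗ[k] MonoidAlgebra k G :=
  toGrp ∘ₗ (ψ : DrinfeldDouble k G →ₗ[k] DrinfeldDouble k G) ∘ₗ smashLin 1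

/-- The component `r(g) = (id ⊗ ε)(ψ(ε # g))` of `ψ`; here the counit `ε` of `kG`,
as an element of `k^G`, is the constant function `1`. -/
noncomputable def compR (ψ : DrinfeldDouble k G ≃ₐc[k] DrinfeldDouble k G) (g : G) : G → k :=
  toDual (ψ (smash 1 g))

/-- The component `v(g) = (ev_1 ⊗ id)(ψ(ε # g))` of `ψ`. -/
noncomputable def compV (ψ : DrinfeldDouble k G ≃ₐc[k] DrinfeldDouble k G) (g : G) :
    MonoidAlgebra k G :=
  toGrp (ψ (smash 1 g))

theorem toDual_e (g h : G) : toDual (e g h : DrinfeldDouble k G) = Pi.single g 1 := by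
  have := (basis (k := k) (G := G)).constr_basis k
    (fun p : G × G => (Pi.single p.1 1 : G → k)) (g, h)
  rwa [basis_app] at this

theorem toGrp_e (g h : G) : toGrp (e g h : DrinfeldDouble k G) =
    if g = 1 then MonoidAlgebra.of k G h else 0 := by
  have := (basis (k := k) (G := G)).constr_basis k
    (fun p : G × G => if p.1 = 1 then MonoidAlgebra.of k G p.2 else 0) (g, h)
  rwa [basis_app] at this

theorem smash_one_eq_sum (h : G) : (smash 1 h : DrinfeldDouble k G) = ∑ g, e g h := by
  rw [smash_eq_sum]
  simp

theorem comul_smash_one (h : G) : CoalgebraStruct.comul (R := k) (smash 1 h : DrinfeldDouble k G) =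
    smash 1 h ⊗ₜ[k] smash 1 h := by
  rw [smash_one_eq_sum, map_sum]
  simp only [comul_e, TensorProduct.sum_tmul, TensorProduct.tmul_sum]
  rw [Finset.sum_comm]
  refine Finset.sum_congr rfl fun a _ => ?_
  exact Fintype.sum_equiv (Equiv.mulLeft a⁻¹) _ _ fun g => rfl

/-- The linear isomorphism `k^G ⊗ kG → D(G)`, `a ⊗ h ↦ a # h`, as a linear map. -/
noncomputable def ofTensor : (G → k) ⊗[k] MonoidAlgebra k G →ₗ[k] DrinfeldDouble k G :=
  TensorProduct.lift (LinearMap.flip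
    ((Finsupp.lift ((G → k) →ₗ[k] DrinfeldDouble k G) k G smashLin) ∘ₗ
      (MonoidAlgebra.coeffLinearEquiv k).toLinearMap))

theorem ofTensor_tmul (a : G → k) (h : G) :
    ofTensor (a ⊗ₜ[k] MonoidAlgebra.of k G h) = smash a h := by
  simp [ofTensor, smashLin]

theorem ofTensor_comul (x : DrinfeldDouble k G) :
    ofTensor (TensorProduct.map toDual toGrp (CoalgebraStruct.comul (R := k) x)) = x := by
  have : ofTensor ∘ₗ TensorProduct.map toDual toGrp ∘ₗ CoalgebraStruct.comul (R := k) =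
      (LinearMap.id : DrinfeldDouble k G →ₗ[k] DrinfeldDouble k G) := by
    apply hom_ext
    intro g h
    simp only [LinearMap.comp_apply, comul_e, map_sum, TensorProduct.map_tmul, toDual_e, toGrp_e,
      LinearMap.id_apply]
    rw [Finset.sum_eq_single 1]
    · rw [if_pos rfl, ofTensor_tmul]
      simp [e]
    · intro a _ ha
      simp [ha]
    · simp
  exact LinearMap.congr_fun this x

theorem apply_smash_one (ψ : DrinfeldDouble k G ≃ₐc[k] DrinfeldDouble k G) (g h : G)
    (hr : compR ψ g = 1) (hv : compV ψ g = MonoidAlgebra.of k G h) :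
    ψ (smash 1 g) = smash 1 h := by
  have h1 : CoalgebraStruct.comul (R := k) (ψ (smash 1 g)) =
      ψ (smash 1 g) ⊗ₜ[k] ψ (smash 1 g) := by
    rw [← CoalgHomClass.map_comp_comul_apply, comul_smash_one]
    rfl
  rw [← ofTensor_comul (ψ (smash 1 g)), h1, TensorProduct.map_tmul]
  change ofTensor (compR ψ g ⊗ₜ[k] compV ψ g) = _
  rw [hr, hv, ofTensor_tmul]

theorem toDual_mul_smash_one (x : DrinfeldDouble k G) (h : G) :
    toDual (x * smash 1 h) = toDual x := by
  have : toDual ∘ₗ LinearMap.mulRight k (smash 1 h : DrinfeldDouble k G) = toDual := by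
    apply hom_ext
    intro g y
    simp only [LinearMap.comp_apply, LinearMap.mulRight_apply, smash_one_eq_sum, Finset.mul_sum,
      e_mul_e, map_sum]
    rw [Finset.sum_eq_single (y⁻¹ * g * y)]
    · rw [if_pos (by group), toDual_e, toDual_e]
    · intro b _ hb
      rw [if_neg, map_zero]
      rintro rfl
      exact hb (by group)
    · simp
  exact LinearMap.congr_fun this x

theorem e_eq_mul (g h : G) : (e g h : DrinfeldDouble k G) = smash (Pi.single g 1) 1 * smash 1 h := by
  rw [smash_one_eq_sum, Finset.mul_sum]
  change _ = ∑ x, e g 1 * e x h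
  simp [e_mul_e]

/-- The condition `ψ = (p, id, 1, id)`. -/
def IsLambda (ψ : DrinfeldDouble k G ≃ₐc[k] DrinfeldDouble k G) : Prop :=
  compU ψ = LinearMap.id ∧ (∀ g, compR ψ g = 1) ∧ ∀ g, compV ψ g = MonoidAlgebra.of k G g

theorem isLambda_iff (ψ : DrinfeldDouble k G ≃ₐc[k] DrinfeldDouble k G) :
    IsLambda ψ ↔ (∀ x, toDual (ψ x) = toDual x) ∧ ∀ g, ψ (smash 1 g) = smash 1 g := by
  constructor
  · rintro ⟨hu, hr, hv⟩
    have hg : ∀ g, ψ (smash 1 g) = smash 1 g := fun g => apply_smash_one ψ g g (hr g) (hv g)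
    refine ⟨fun x => ?_, hg⟩
    have : toDual ∘ₗ (ψ : DrinfeldDouble k G →ₗ[k] DrinfeldDouble k G) = toDual := by
      apply hom_ext
      intro g h
      change toDual (ψ (e g h)) = _
      rw [e_eq_mul, map_mul, hg, toDual_mul_smash_one, toDual_mul_smash_one]
      have h1 : toDual (ψ (smash (Pi.single g 1) 1)) = Pi.single g 1 :=
        LinearMap.congr_fun hu (Pi.single g 1)
      rw [h1]
      exact (toDual_e g 1).symm
    exact LinearMap.congr_fun this x
  · rintro ⟨hu, hg⟩
    refine ⟨?_, fun g => ?_, fun g => ?_⟩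
    · refine (Pi.basisFun k G).ext fun g => ?_
      change toDual (ψ (smash (Pi.basisFun k G g) 1)) = Pi.basisFun k G g
      rw [hu, Pi.basisFun_apply]
      exact toDual_e g 1
    · rw [compR, hg, smash_one_eq_sum, map_sum]
      simp only [toDual_e]
      exact Finset.univ_sum_single (1 : G → k)
    · rw [compV, hg, smash_one_eq_sum, map_sum]
      simp [toGrp_e]

/-- The subgroup `Λ(G)` of all automorphisms of `D(G)` of the form `(p, id, 1, id)`. -/
def Lam (k G : Type*) [Field k] [Group G] [Fintype G] [DecidableEq G] :
    Subgroup (DrinfeldDouble k G ≃ₐc[k] DrinfeldDouble k G) where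
  carrier := {ψ | IsLambda ψ}
  mul_mem' := by
    intro f g hf hg
    rw [Set.mem_ofPred_eq, isLambda_iff] at *
    refine ⟨fun x => ?_, fun y => ?_⟩
    · change toDual (f (g x)) = _
      rw [hf.1, hg.1]
    · change f (g (smash 1 y)) = _
      rw [hg.2, hf.2]
  one_mem' := by
    rw [Set.mem_ofPred_eq, isLambda_iff]
    exact ⟨fun _ => rfl, fun _ => rfl⟩
  inv_mem' := by
    intro f hf
    rw [Set.mem_ofPred_eq, isLambda_iff] at *
    have h : ∀ x, f (f⁻¹ x) = x := fun x => f.toEquiv.apply_symm_apply x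
    have h' : ∀ x, f⁻¹ (f x) = x := fun x => f.toEquiv.symm_apply_apply x
    refine ⟨fun x => ?_, fun y => ?_⟩
    · rw [← hf.1, h]
    · conv_lhs => rw [← hf.2 y, h']

end DrinfeldDouble

/-- The restriction of an automorphism of `G` to the center of `G`. -/
def centerRestrict {G : Type*} [Group G] (v : MulAut G) :
    Subgroup.center G →* Subgroup.center G where
  toFun z := ⟨v z, by
    rw [Subgroup.mem_center_iff]
    intro g
    have h := Subgroup.mem_center_iff.mp z.2 (v.symm g)
    have h2 := congrArg v h
    simpa using h2⟩
  map_one' := by ext; simp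
  map_mul' x y := by ext; simp

namespace DrinfeldDouble

variable {k G : Type*} [Field k] [Group G] [Fintype G] [DecidableEq G]

/-! As a coalgebra `D(G)` is `(k^G)^cop ⊗ kG`, so its group-like elements are the `χ # h` with `χ` a
linear character of `G`. If `G` is perfect, only the `1 # h` remain. An automorphism `ψ` permutes
them through some `v ∈ Aut(G)` (`exists_mulAut`), and dividing by `mapAut v` leaves a `ψ` that fixes
every `1 # g`.

For such a `ψ` the transpose of `u` is a multiplicative map `t : G → kG`, equivariant for
conjugation, whose image spans `kG`. Hence `h⁻¹ t(h)` is central and multiplicative in `h`, so it is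
trivial on a perfect group and `u = id` (`transposeU_eq_of`). Thus `Aut(D(G)) = Λ(G) ⋊ Aut(G)`.

For any `G`, `Λ(G)` is `Hom(Ẑ, Z)`, where `Z` is the center and `Ẑ` its dual. The central
idempotents `idem χ`, `χ ∈ Ẑ`, split `D(G)`, and a homomorphism `b : Ẑ → Z` gives the automorphism
`lamAut b` that translates the `χ`-component by `b χ`. Conversely, for `ψ ∈ Λ(G)` the component `p`
takes values in `kZ` (`apply_eq_zero_of_mem_Lam`), and `χ ∘ p` is an algebra map `k^G → k`, that is,
evaluation at a point `b χ`; the bialgebra axioms make `b χ` central and `b` multiplicative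
(`exists_lamAut_eq`). An isomorphism `Ẑ ≅ Z` turns `Hom(Ẑ, Z)` into `End(Z)`.

If `Aut(D(G)) ≅ Aut(G)`, finiteness forces the injection `mapAut` to be onto. A nontrivial center
would give an automorphism `lamAut b` outside its image, and a nontrivial abelianization an
automorphism `twistAut r` outside it. -/

theorem map_mul_of_basis (f : DrinfeldDouble k G →ₗ[k] DrinfeldDouble k G)
    (h : ∀ g x h y, f (e g x * e h y) = f (e g x) * f (e h y)) (x y : DrinfeldDouble k G) :
    f (x * y) = f x * f y := by
  have h' : (LinearMap.mul k (DrinfeldDouble k G)).compr₂ f =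
      (LinearMap.mul k (DrinfeldDouble k G)).compl₁₂ f f := bilin_ext h
  exact LinearMap.congr_fun (LinearMap.congr_fun h' x) y

/-- A linear endomorphism of `D(G)` which respects the structure maps on the basis `e_g # h` is a
bialgebra map. -/
noncomputable def bialgHomOfBasis (f : DrinfeldDouble k G →ₗ[k] DrinfeldDouble k G)
    (h_one : f 1 = 1)
    (h_mul : ∀ g x h y, f (e g x * e h y) = f (e g x) * f (e h y))
    (h_counit : ∀ g x, CoalgebraStruct.counit (R := k) (f (e g x)) =
      CoalgebraStruct.counit (R := k) (e g x : DrinfeldDouble k G))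
    (h_comul : ∀ g x, TensorProduct.map f f (CoalgebraStruct.comul (R := k) (e g x)) =
      CoalgebraStruct.comul (R := k) (f (e g x))) :
    DrinfeldDouble k G →ₐc[k] DrinfeldDouble k G :=
  BialgHom.ofAlgHom
    (AlgHom.ofLinearMap f h_one (map_mul_of_basis f h_mul))
    (AlgHom.toLinearMap_injective (hom_ext h_counit))
    (AlgHom.toLinearMap_injective (hom_ext h_comul))

theorem aut_mul_apply (ψ χ : DrinfeldDouble k G ≃ₐc[k] DrinfeldDouble k G)
    (x : DrinfeldDouble k G) : (ψ * χ) x = ψ (χ x) := rfl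

theorem aut_one_apply (x : DrinfeldDouble k G) :
    (1 : DrinfeldDouble k G ≃ₐc[k] DrinfeldDouble k G) x = x := rfl

theorem aut_apply_inv_apply (ψ : DrinfeldDouble k G ≃ₐc[k] DrinfeldDouble k G)
    (x : DrinfeldDouble k G) : ψ (ψ⁻¹ x) = x := ψ.toEquiv.apply_symm_apply x

theorem aut_ext {ψ χ : DrinfeldDouble k G ≃ₐc[k] DrinfeldDouble k G}
    (h : ∀ g x, ψ (e g x) = χ (e g x)) : ψ = χ := by
  have : (ψ : DrinfeldDouble k G →ₗ[k] DrinfeldDouble k G) = χ := hom_ext h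
  exact BialgEquiv.ext fun x => LinearMap.congr_fun this x

/-- A monoid homomorphism into the bialgebra endomorphisms of `D(G)`, defined on a group, takes
values in the automorphisms. -/
noncomputable def autOfHom {H : Type*} [Group H]
    (F : H → DrinfeldDouble k G →ₐc[k] DrinfeldDouble k G)
    (h_one : ∀ x, F 1 x = x) (h_mul : ∀ a b x, F (a * b) x = F a (F b x)) :
    H →* (DrinfeldDouble k G ≃ₐc[k] DrinfeldDouble k G) where
  toFun a := BialgEquiv.ofBialgHom (F a) (F a⁻¹)
    (BialgHom.ext fun x => by
      change F a (F a⁻¹ x) = x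
      rw [← h_mul, mul_inv_cancel, h_one])
    (BialgHom.ext fun x => by
      change F a⁻¹ (F a x) = x
      rw [← h_mul, inv_mul_cancel, h_one])
  map_one' := BialgEquiv.ext h_one
  map_mul' a b := BialgEquiv.ext (h_mul a b)

theorem constr_e {M : Type*} [AddCommMonoid M] [Module k M] (f : G × G → M) (g h : G) :
    basis.constr k f (e g h : DrinfeldDouble k G) = f (g, h) := by
  have := (basis (k := k) (G := G)).constr_basis k f (g, h)
  rwa [basis_app] at this

theorem e_inj {g h g' h' : G} : (e g h : DrinfeldDouble k G) = e g' h' ↔ g = g' ∧ h = h' := by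
  have := (basis (k := k) (G := G)).injective.eq_iff (a := (g, h)) (b := (g', h'))
  rwa [basis_app, basis_app, Prod.mk.injEq] at this

/-! ### Automorphisms induced by automorphisms of the group -/

/-- The linear map `e_g # h ↦ e_{v(g)} # v(h)`. -/
noncomputable def mapLin (v : MulAut G) : DrinfeldDouble k G →ₗ[k] DrinfeldDouble k G :=
  basis.constr k fun p => e (v p.1) (v p.2)

theorem mapLin_e (v : MulAut G) (g h : G) :
    mapLin v (e g h : DrinfeldDouble k G) = e (v g) (v h) := constr_e _ _ _

theorem mapLin_smash_one (v : MulAut G) (h : G) :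
    mapLin v (smash 1 h : DrinfeldDouble k G) = smash 1 (v h) := by
  simp only [smash_one_eq_sum, map_sum, mapLin_e]
  exact Fintype.sum_equiv v.toEquiv _ _ fun g => rfl

/-- The bialgebra map `e_g # h ↦ e_{v(g)} # v(h)`. -/
noncomputable def mapHom (v : MulAut G) : DrinfeldDouble k G →ₐc[k] DrinfeldDouble k G :=
  bialgHomOfBasis (mapLin v)
    (by rw [one_def, mapLin_smash_one, map_one])
    (fun g x h y => by
      have : v g = v x * v h * (v x)⁻¹ ↔ g = x * h * x⁻¹ := by
        rw [← map_inv, ← map_mul, ← map_mul, v.injective.eq_iff]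
      simp only [e_mul_e, mapLin_e, this]
      split_ifs <;> simp [mapLin_e])
    (fun g x => by simp [mapLin_e, counit_e])
    (fun g x => by
      simp only [mapLin_e, comul_e, map_sum, TensorProduct.map_tmul]
      exact Fintype.sum_equiv v.toEquiv _ _ fun a => by simp)

/-- The homomorphism `Aut(G) → Aut(D(G))`, sending `v` to `e_g # h ↦ e_{v(g)} # v(h)`. -/
noncomputable def mapAut : MulAut G →* (DrinfeldDouble k G ≃ₐc[k] DrinfeldDouble k G) :=
  autOfHom mapHom
    (fun x => by
      have : mapLin (1 : MulAut G) = (LinearMap.id : DrinfeldDouble k G →ₗ[k] _) :=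
        hom_ext fun g h => by simp [mapLin_e]
      exact LinearMap.congr_fun this x)
    (fun v w x => by
      have : mapLin (v * w) = (mapLin v ∘ₗ mapLin w : DrinfeldDouble k G →ₗ[k] _) :=
        hom_ext fun g h => by simp [mapLin_e]
      exact LinearMap.congr_fun this x)

@[simp]
theorem mapAut_e (v : MulAut G) (g h : G) :
    mapAut v (e g h : DrinfeldDouble k G) = e (v g) (v h) := mapLin_e v g h

@[simp]
theorem mapAut_smash_one (v : MulAut G) (h : G) :
    mapAut v (smash 1 h : DrinfeldDouble k G) = smash 1 (v h) := mapLin_smash_one v h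

theorem mapAut_injective :
    Function.Injective (mapAut : MulAut G →* (DrinfeldDouble k G ≃ₐc[k] DrinfeldDouble k G)) := by
  intro v w h
  ext g
  have := DFunLike.congr_fun h (e g 1)
  rw [mapAut_e, mapAut_e, e_inj] at this
  exact this.1

theorem toDual_mapAut (v : MulAut G) (x : DrinfeldDouble k G) :
    toDual (mapAut v x) = toDual x ∘ (v⁻¹ : MulAut G) := by
  have : toDual ∘ₗ mapLin v = LinearMap.funLeft k k (v⁻¹ : MulAut G) ∘ₗ
      (toDual : DrinfeldDouble k G →ₗ[k] _) := by
    apply hom_ext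
    intro g h
    ext a
    simp only [LinearMap.comp_apply, mapLin_e, toDual_e, LinearMap.funLeft_apply,
      Pi.single_apply, MulAut.inv_def, MulEquiv.symm_apply_eq]
  exact LinearMap.congr_fun this x

theorem toGrp_mapAut (v : MulAut G) (x : DrinfeldDouble k G) :
    toGrp (mapAut v x) = MonoidAlgebra.mapDomainAlgHom k k (v : G →* G) (toGrp x) := by
  have : toGrp ∘ₗ mapLin v = (MonoidAlgebra.mapDomainAlgHom k k (v : G →* G)).toLinearMap ∘ₗ
      (toGrp : DrinfeldDouble k G →ₗ[k] _) := by
    apply hom_ext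
    intro g h
    simp only [LinearMap.comp_apply, mapLin_e, toGrp_e, EmbeddingLike.map_eq_one_iff]
    split_ifs <;> simp
  exact LinearMap.congr_fun this x

theorem mapAut_smash (v : MulAut G) (a : G → k) (h : G) :
    mapAut v (smash (a ∘ v) h) = smash a (v h) := by
  simp only [smash_eq_sum, map_sum, map_smul, mapAut_e]
  exact Fintype.sum_equiv v.toEquiv _ _ fun g => rfl

/-! ### Automorphisms given by a bicharacter of the group -/

/-- The linear map `e_g # h ↦ r(h)(g) e_g # h`. -/
noncomputable def twistLin (r : G →* G →* kˣ) : DrinfeldDouble k G →ₗ[k] DrinfeldDouble k G :=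
  basis.constr k fun p => (r p.2 p.1 : k) • e p.1 p.2

theorem twistLin_e (r : G →* G →* kˣ) (g h : G) :
    twistLin r (e g h : DrinfeldDouble k G) = (r h g : k) • e g h := constr_e _ _ _

/-- The bialgebra map `e_g # h ↦ r(h)(g) e_g # h`. -/
noncomputable def twistHom (r : G →* G →* kˣ) : DrinfeldDouble k G →ₐc[k] DrinfeldDouble k G :=
  bialgHomOfBasis (twistLin r)
    (by simp [one_eq_sum, twistLin_e])
    (fun g x h y => by
      simp only [e_mul_e, twistLin_e, smul_mul_smul_comm]
      split_ifs with hg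
      · rw [twistLin_e]
        -- The character `r y` takes the same value at `h` and at `x h x⁻¹`, because its values
        -- commute; so the two scalars combine to that of `x y`.
        subst hg
        simp
      · simp)
    (fun g x => by
      simp only [twistLin_e, counit_e, map_smul]
      split_ifs with hg <;> simp [hg])
    (fun g x => by
      simp only [twistLin_e, comul_e, map_sum, TensorProduct.map_tmul, map_smul, Finset.smul_sum,
        TensorProduct.smul_tmul_smul]
      refine Finset.sum_congr rfl fun a _ => ?_
      rw [← Units.val_mul, mul_comm, ← map_mul, mul_inv_cancel_left])

/-- The homomorphism from the bicharacters of `G` to `Aut(D(G))`, sending `r` to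
`e_g # h ↦ r(h)(g) e_g # h`. -/
noncomputable def twistAut :
    (G →* G →* kˣ) →* (DrinfeldDouble k G ≃ₐc[k] DrinfeldDouble k G) :=
  autOfHom twistHom
    (fun x => by
      have : twistLin (1 : G →* G →* kˣ) = (LinearMap.id : DrinfeldDouble k G →ₗ[k] _) :=
        hom_ext fun g h => by simp [twistLin_e]
      exact LinearMap.congr_fun this x)
    (fun v w x => by
      have : twistLin (v * w) = (twistLin v ∘ₗ twistLin w : DrinfeldDouble k G →ₗ[k] _) :=
        hom_ext fun g h => by simp [twistLin_e, mul_smul, smul_comm (v h g : k)]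
      exact LinearMap.congr_fun this x)

@[simp]
theorem twistAut_e (r : G →* G →* kˣ) (g h : G) :
    twistAut r (e g h : DrinfeldDouble k G) = (r h g : k) • e g h := twistLin_e r g h

/-- A twist scales each basis vector by a unit, while `mapAut v` permutes the basis: the coefficient
at `e_g # x` is nonzero on one side and `0` or `1` on the other. -/
theorem eq_one_of_twistAut_eq_mapAut {r : G →* G →* kˣ} {v : MulAut G}
    (h : (twistAut r : DrinfeldDouble k G ≃ₐc[k] DrinfeldDouble k G) = mapAut v) : r = 1 := by
  ext x g
  have h1 := congrFun (DFunLike.congr_fun h (e g x)) (g, x)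
  rw [twistAut_e, mapAut_e, smul_app, e_app, e_app, if_pos rfl, if_pos rfl, mul_one] at h1
  have h2 : (r x g : k) ≠ 0 := Units.ne_zero _
  split_ifs at h1
  · simpa using h1
  · exact absurd h1 h2
  · exact absurd h1 h2

end DrinfeldDouble

namespace DrinfeldDouble

variable {k G : Type*} [Field k] [Group G] [Fintype G] [DecidableEq G]

/-- The coefficient of a basis element `e_g # h`. -/
def coord (p : G × G) : DrinfeldDouble k G →ₗ[k] k where
  toFun x := x p
  map_add' _ _ := rfl
  map_smul' _ _ := rfl

theorem coord_apply (p : G × G) (x : DrinfeldDouble k G) : coord p x = x p := rfl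

/-! ### Multiplication by group elements -/

theorem smash_one_mul_e (x h y : G) :
    (smash 1 x * e h y : DrinfeldDouble k G) = e (x * h * x⁻¹) (x * y) := by
  rw [smash_one_eq_sum, Finset.sum_mul, Finset.sum_eq_single (x * h * x⁻¹)]
  · rw [e_mul_e, if_pos rfl]
  · intro g _ hg
    rw [e_mul_e, if_neg hg]
  · simp

theorem e_mul_smash_one (g x y : G) :
    (e g x * smash 1 y : DrinfeldDouble k G) = e g (x * y) := by
  rw [smash_one_eq_sum, Finset.mul_sum, Finset.sum_eq_single (x⁻¹ * g * x)]
  · rw [e_mul_e, if_pos (by group)]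
  · intro h _ hh
    rw [e_mul_e, if_neg]
    rintro rfl
    exact hh (by group)
  · simp

theorem smash_one_mul_smash_one (x y : G) :
    (smash 1 x * smash 1 y : DrinfeldDouble k G) = smash 1 (x * y) := by
  simp only [smash_one_eq_sum (k := k) x, Finset.sum_mul, e_mul_smash_one]
  rw [smash_one_eq_sum]

theorem smash_one_center_mul (z : Subgroup.center G) (x : DrinfeldDouble k G) :
    smash 1 (z : G) * x = x * smash 1 (z : G) := by
  have : LinearMap.mulLeft k (smash 1 (z : G) : DrinfeldDouble k G) =
      LinearMap.mulRight k (smash 1 (z : G)) := by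
    apply hom_ext
    intro g h
    have hz := fun g => Subgroup.mem_center_iff.mp z.2 g
    simp only [LinearMap.mulLeft_apply, LinearMap.mulRight_apply, smash_one_mul_e,
      e_mul_smash_one, ← hz]
    simp
  exact LinearMap.congr_fun this x

theorem counit_smash_one (h : G) :
    CoalgebraStruct.counit (R := k) (smash 1 h : DrinfeldDouble k G) = 1 := by
  simp [smash_one_eq_sum, counit_e]

theorem counit_eq_toDual (x : DrinfeldDouble k G) :
    CoalgebraStruct.counit (R := k) x = toDual x 1 := by
  have : CoalgebraStruct.counit (R := k) = LinearMap.proj 1 ∘ₗ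
      (toDual : DrinfeldDouble k G →ₗ[k] _) :=
    hom_ext fun g h => by simp [counit_e, toDual_e, Pi.single_apply, eq_comm]
  exact LinearMap.congr_fun this x

theorem toDual_smash_one_mul (h : G) (x : DrinfeldDouble k G) (a : G) :
    toDual (smash 1 h * x) a = toDual x (h⁻¹ * a * h) := by
  have : toDual ∘ₗ LinearMap.mulLeft k (smash 1 h) = LinearMap.funLeft k k (fun a => h⁻¹ * a * h) ∘ₗ
      (toDual : DrinfeldDouble k G →ₗ[k] _) := by
    apply hom_ext
    intro g y
    ext a
    have : a = h * g * h⁻¹ ↔ h⁻¹ * a * h = g := by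
      rw [eq_mul_inv_iff_mul_eq, mul_assoc, inv_mul_eq_iff_eq_mul]
    simp [smash_one_mul_e, toDual_e, LinearMap.funLeft_apply, Pi.single_apply, this]
  exact congrFun (LinearMap.congr_fun this x) a

/-! ### Translation by central elements -/

/-- The linear map `e_g # h ↦ e_{g s⁻¹} # h`. -/
noncomputable def shift (s : Subgroup.center G) :
    DrinfeldDouble k G →ₗ[k] DrinfeldDouble k G :=
  basis.constr k fun p => e (p.1 * (s : G)⁻¹) p.2

theorem shift_e (s : Subgroup.center G) (g h : G) :
    shift s (e g h : DrinfeldDouble k G) = e (g * (s : G)⁻¹) h := constr_e _ _ _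

theorem shift_smash_one (s : Subgroup.center G) (h : G) :
    shift s (smash 1 h : DrinfeldDouble k G) = smash 1 h := by
  simp only [smash_one_eq_sum, map_sum, shift_e]
  exact Fintype.sum_equiv (Equiv.mulRight (s : G)⁻¹) _ _ fun g => rfl

theorem shift_one (x : DrinfeldDouble k G) : shift 1 x = x := by
  have : shift 1 = (LinearMap.id : DrinfeldDouble k G →ₗ[k] _) :=
    hom_ext fun g h => by simp [shift_e]
  exact LinearMap.congr_fun this x

theorem shift_mul (s t : Subgroup.center G) (x : DrinfeldDouble k G) :
    shift (s * t) x = shift s (shift t x) := by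
  have : shift (s * t) = (shift s ∘ₗ shift t : DrinfeldDouble k G →ₗ[k] _) :=
    hom_ext fun g h => by simp [shift_e, mul_assoc]
  exact LinearMap.congr_fun this x

/-- Translating `g` and `h` by the same central element preserves the relation `g = x h x⁻¹` that
governs the product. -/
theorem shift_map_mul (s : Subgroup.center G) (x y : DrinfeldDouble k G) :
    shift s (x * y) = shift s x * shift s y := by
  refine map_mul_of_basis _ (fun g x h y => ?_) x y
  have hz := fun g => Subgroup.mem_center_iff.mp (inv_mem s.2) g
  have : g * (s : G)⁻¹ = x * (h * (s : G)⁻¹) * x⁻¹ ↔ g = x * h * x⁻¹ := by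
    rw [mul_assoc x, mul_assoc h, ← hz x⁻¹, ← mul_assoc, ← mul_assoc, mul_left_inj]
  simp only [shift_e, e_mul_e, this]
  split_ifs <;> simp [shift_e]

/-- The coproduct on `k^G` is dual to multiplication in `G`, so a translation by `s t` can be
distributed over the two tensor factors, centrality making the order irrelevant. -/
theorem comul_shift (s t : Subgroup.center G) (x : DrinfeldDouble k G) :
    CoalgebraStruct.comul (R := k) (shift (s * t) x) =
      TensorProduct.map (shift s) (shift t) (CoalgebraStruct.comul (R := k) x) := by
  have : CoalgebraStruct.comul (R := k) ∘ₗ shift (s * t) =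
      TensorProduct.map (shift s) (shift t) ∘ₗ
        (CoalgebraStruct.comul (R := k) : DrinfeldDouble k G →ₗ[k] _) := by
    apply hom_ext
    intro g h
    have hz := fun g => Subgroup.mem_center_iff.mp t.2 g
    simp only [LinearMap.comp_apply, shift_e, comul_e, map_sum, TensorProduct.map_tmul]
    refine Fintype.sum_equiv (Equiv.mulRight (t : G)) _ _ fun a => ?_
    have hz' := fun g => Subgroup.mem_center_iff.mp (inv_mem t.2) g
    simp only [Equiv.coe_mulRight, Subgroup.coe_mul, mul_inv_rev, mul_assoc]
    rw [← hz', ← hz']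
    simp only [mul_assoc, mul_inv_cancel, mul_one]
  exact LinearMap.congr_fun this x

theorem mapAut_shift (v : MulAut G) (s : Subgroup.center G) (x : DrinfeldDouble k G) :
    mapAut v (shift s x) = shift (centerRestrict v s) (mapAut v x) := by
  have : mapLin v ∘ₗ shift s = shift (centerRestrict v s) ∘ₗ
      (mapLin v : DrinfeldDouble k G →ₗ[k] _) :=
    hom_ext fun g h => by simp [shift_e, mapLin_e, centerRestrict]
  exact LinearMap.congr_fun this x

/-- The restriction of an automorphism of `G` to the center of `G`, as a bijection. -/
def centerEquiv (v : MulAut G) : Subgroup.center G ≃ Subgroup.center G where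
  toFun := centerRestrict v
  invFun := centerRestrict v⁻¹
  left_inv z := by ext; simp [centerRestrict]
  right_inv z := by ext; simp [centerRestrict]

/-! ### Characters of the center and the idempotents they define -/

variable (k G) in
/-- The group of characters of the center of `G`. -/
abbrev CenterDual : Type _ := Subgroup.center G →* kˣ

instance : Finite (CenterDual k G) := inferInstance

noncomputable instance : Fintype (CenterDual k G) := Fintype.ofFinite _

open Classical in
theorem sum_centerDual_apply (χ : CenterDual k G) :
    ∑ z, (χ z : k) = if χ = 1 then (Fintype.card (Subgroup.center G) : k) else 0 := by
  have := sum_hom_units ((Units.coeHom k).comp χ)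
  have h : (Units.coeHom k).comp χ = 1 ↔ χ = 1 := by
    simp [DFunLike.ext_iff]
  simpa [h] using this

variable [IsAlgClosed k] [CharZero k]

theorem card_center_ne_zero : (Fintype.card (Subgroup.center G) : k) ≠ 0 :=
  Nat.cast_ne_zero.mpr Fintype.card_ne_zero

/-- The second orthogonality relation. Evaluation at `z` is a character of the dual, trivial only
for `z = 1` because `k` has enough roots of unity; the same fact gives the dual the order of the
center. -/
theorem sum_apply_centerDual (z : Subgroup.center G) :
    ∑ χ : CenterDual k G, (χ z : k) =
      if z = 1 then (Fintype.card (Subgroup.center G) : k) else 0 := by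
  classical
  have h := sum_hom_units ((Units.coeHom k).comp (MonoidHom.eval z : CenterDual k G →* kˣ))
  have hcard : Fintype.card (CenterDual k G) = Fintype.card (Subgroup.center G) := by
    rw [Fintype.card_eq_nat_card, Fintype.card_eq_nat_card]
    exact CommGroup.card_monoidHom_of_hasEnoughRootsOfUnity _ k
  have hz : (Units.coeHom k).comp (MonoidHom.eval z : CenterDual k G →* kˣ) = 1 ↔ z = 1 := by
    rw [← CommGroup.forall_apply_eq_apply_iff (Subgroup.center G) (M := k)]
    simp [DFunLike.ext_iff]
  simpa [hz, hcard] using h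

/-- The idempotent `|Z(G)|⁻¹ ∑ χ(z)⁻¹ (1 # z)` of a character `χ` of the center. -/
noncomputable def idem (χ : CenterDual k G) : DrinfeldDouble k G :=
  (Fintype.card (Subgroup.center G) : k)⁻¹ •
    ∑ z : Subgroup.center G, (χ z : k)⁻¹ • smash 1 (z : G)

theorem idem_mul (χ : CenterDual k G) (x : DrinfeldDouble k G) : idem χ * x = x * idem χ := by
  simp only [idem, Finset.sum_mul, Finset.mul_sum, smul_mul_assoc, mul_smul_comm,
    smash_one_center_mul]

theorem smash_one_mul_idem (χ : CenterDual k G) (z : Subgroup.center G) :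
    smash 1 (z : G) * idem χ = (χ z : k) • idem χ := by
  simp only [idem, Finset.mul_sum, mul_smul_comm, Finset.smul_sum, smul_smul,
    smash_one_mul_smash_one]
  refine Fintype.sum_equiv (Equiv.mulLeft z) _ _ fun w => ?_
  simp only [Equiv.coe_mulLeft, map_mul, Units.val_mul, Subgroup.coe_mul]
  congr 1
  field_simp

open Classical in
theorem idem_mul_idem (χ χ' : CenterDual k G) :
    idem χ * idem χ' = if χ = χ' then idem χ' else 0 := by
  have h := sum_centerDual_apply (χ⁻¹ * χ')
  conv_lhs => rw [idem]
  simp only [smul_mul_assoc, Finset.sum_mul, smash_one_mul_idem, smul_smul, ← Finset.sum_smul]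
  have : ∑ z, (χ z : k)⁻¹ * (χ' z : k) = ∑ z, ((χ⁻¹ * χ') z : k) :=
    Finset.sum_congr rfl fun z _ => by simp
  rw [this, h, if_congr (inv_mul_eq_one (G := CenterDual k G)) rfl rfl]
  split_ifs
  · rw [inv_mul_cancel₀ card_center_ne_zero, one_smul]
  · simp

theorem sum_idem : ∑ χ : CenterDual k G, (idem χ : DrinfeldDouble k G) = 1 := by
  simp only [idem, ← Finset.smul_sum]
  rw [Finset.sum_comm]
  simp only [← Finset.sum_smul]
  have : ∀ z : Subgroup.center G, ∑ χ : CenterDual k G, (χ z : k)⁻¹ =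
      if z = 1 then (Fintype.card (Subgroup.center G) : k) else 0 := by
    intro z
    rw [← if_congr inv_eq_one rfl rfl, ← sum_apply_centerDual]
    simp
  simp [this, one_def, smul_smul]

/-- Identities about `lamLin` are checked one component at a time, where it is a plain translation.
-/
theorem eq_of_mul_idem_eq {x y : DrinfeldDouble k G}
    (h : ∀ χ : CenterDual k G, x * idem χ = y * idem χ) : x = y := by
  rw [← mul_one x, ← mul_one y, ← sum_idem, Finset.mul_sum, Finset.mul_sum]
  exact Finset.sum_congr rfl fun χ _ => h χ

open Classical in
theorem counit_idem (χ : CenterDual k G) :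
    CoalgebraStruct.counit (R := k) (idem χ : DrinfeldDouble k G) = if χ = 1 then 1 else 0 := by
  have h := sum_centerDual_apply χ⁻¹
  rw [if_congr (inv_eq_one (α := CenterDual k G)) rfl rfl] at h
  simp only [MonoidHom.inv_apply, Units.val_inv_eq_inv_val] at h
  simp only [idem, map_smul, map_sum, counit_smash_one, smul_eq_mul, mul_one, h]
  split_ifs
  · exact inv_mul_cancel₀ card_center_ne_zero
  · simp

/-- The span of the `1 # z` is the function algebra on the dual of the center, with `idem χ` as
delta function at `χ`; its coproduct runs over the factorizations of `χ`. In terms of the `1 # z ⊗ 1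
# w`, orthogonality removes every term with `z ≠ w`. -/
theorem comul_idem (χ : CenterDual k G) :
    CoalgebraStruct.comul (R := k) (idem χ : DrinfeldDouble k G) =
      ∑ χ₁ : CenterDual k G, idem χ₁ ⊗ₜ[k] (idem (χ₁⁻¹ * χ) : DrinfeldDouble k G) := by
  have key : ∀ z w : Subgroup.center G,
      ∑ χ₁ : CenterDual k G, (χ₁ z : k)⁻¹ * ((χ₁⁻¹ * χ) w : k)⁻¹ =
        if w = z then (Fintype.card (Subgroup.center G) : k) * (χ z : k)⁻¹ else 0 := by
    intro z w
    have h := sum_apply_centerDual (k := k) (z⁻¹ * w)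
    rw [if_congr (inv_mul_eq_one.trans eq_comm) rfl rfl] at h
    have : ∀ χ₁ : CenterDual k G, (χ₁ z : k)⁻¹ * ((χ₁⁻¹ * χ) w : k)⁻¹ =
        (χ₁ (z⁻¹ * w) : k) * (χ w : k)⁻¹ := by
      intro χ₁
      simp only [map_mul, map_inv, MonoidHom.mul_apply, MonoidHom.inv_apply, Units.val_mul,
        Units.val_inv_eq_inv_val, mul_inv, inv_inv]
      ring
    simp only [this, ← Finset.sum_mul, h]
    split_ifs with hw
    · rw [hw]
    · simp
  have hc := card_center_ne_zero (k := k) (G := G)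
  have expand : ∀ χ₁ χ₂ : CenterDual k G,
      idem χ₁ ⊗ₜ[k] (idem χ₂ : DrinfeldDouble k G) =
        ∑ z : Subgroup.center G, ∑ w : Subgroup.center G,
          ((χ₁ z : k)⁻¹ * (χ₂ w : k)⁻¹) •
            ((Fintype.card (Subgroup.center G) : k)⁻¹ * (Fintype.card (Subgroup.center G) : k)⁻¹) •
              (smash 1 (z : G) ⊗ₜ[k] (smash 1 (w : G) : DrinfeldDouble k G)) := by
    intro χ₁ χ₂
    simp only [idem, TensorProduct.smul_tmul_smul, TensorProduct.sum_tmul,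
      TensorProduct.tmul_sum, Finset.smul_sum]
    rw [Finset.sum_comm]
    refine Finset.sum_congr rfl fun z _ => Finset.sum_congr rfl fun w _ => ?_
    rw [smul_comm]
  simp only [expand]
  rw [Finset.sum_comm, Finset.sum_congr rfl fun z _ => Finset.sum_comm]
  simp only [← Finset.sum_smul, key]
  simp only [idem, map_smul, map_sum, comul_smash_one, Finset.smul_sum]
  refine Finset.sum_congr rfl fun z _ => ?_
  rw [Finset.sum_eq_single z (fun w _ hw => by rw [if_neg hw, zero_smul]) (by simp), if_pos rfl,
    smul_smul, smul_smul]
  congr 1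
  field_simp

theorem mapAut_idem (v : MulAut G) (χ : CenterDual k G) :
    mapAut v (idem (χ.comp (centerRestrict v)) : DrinfeldDouble k G) = idem χ := by
  simp only [idem, map_smul, map_sum, mapAut_smash_one]
  congr 1
  exact Fintype.sum_equiv (centerEquiv v) _ _ fun z => rfl

theorem toDual_mul_idem (x : DrinfeldDouble k G) (χ : CenterDual k G) :
    toDual (x * idem χ) = CoalgebraStruct.counit (R := k) (idem χ) • toDual x := by
  simp only [idem, Finset.mul_sum, mul_smul_comm, map_smul, map_sum, toDual_mul_smash_one,
    counit_smash_one, ← Finset.sum_smul, smul_smul, smul_eq_mul, mul_one]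

end DrinfeldDouble

namespace DrinfeldDouble

variable {k G : Type*} [Field k] [Group G] [Fintype G] [DecidableEq G]
variable [IsAlgClosed k] [CharZero k]

/-! ### The automorphisms `(p, id, 1, id)` -/

/-- The linear map which translates by `b(χ)` on the component of the character `χ`. -/
noncomputable def lamLin (b : CenterDual k G →* Subgroup.center G) :
    DrinfeldDouble k G →ₗ[k] DrinfeldDouble k G :=
  ∑ χ : CenterDual k G, LinearMap.mulRight k (idem χ) ∘ₗ shift (b χ)

theorem lamLin_apply (b : CenterDual k G →* Subgroup.center G) (x : DrinfeldDouble k G) :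
    lamLin b x = ∑ χ : CenterDual k G, shift (b χ) x * idem χ := by
  simp [lamLin]

theorem lamLin_mul_idem (b : CenterDual k G →* Subgroup.center G) (x : DrinfeldDouble k G)
    (χ : CenterDual k G) : lamLin b x * idem χ = shift (b χ) x * idem χ := by
  classical
  simp only [lamLin_apply, Finset.sum_mul, mul_assoc, idem_mul_idem]
  simp

theorem lamLin_smash_one (b : CenterDual k G →* Subgroup.center G) (g : G) :
    lamLin b (smash 1 g : DrinfeldDouble k G) = smash 1 g := by
  rw [lamLin_apply]
  simp only [shift_smash_one, ← Finset.mul_sum, sum_idem, mul_one]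

theorem lamLin_idem (b : CenterDual k G →* Subgroup.center G) (χ : CenterDual k G) :
    lamLin b (idem χ : DrinfeldDouble k G) = idem χ := by
  simp [idem, lamLin_smash_one]

theorem lamLin_map_mul (b : CenterDual k G →* Subgroup.center G) (x y : DrinfeldDouble k G) :
    lamLin b (x * y) = lamLin b x * lamLin b y := by
  apply eq_of_mul_idem_eq
  intro χ
  rw [lamLin_mul_idem, shift_map_mul, mul_assoc (lamLin b x), lamLin_mul_idem,
    ← idem_mul χ (shift (b χ) y), ← mul_assoc, lamLin_mul_idem, mul_assoc _ (idem χ), idem_mul,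
    mul_assoc]

theorem lamLin_comp (b b' : CenterDual k G →* Subgroup.center G) (x : DrinfeldDouble k G) :
    lamLin (b * b') x = lamLin b (lamLin b' x) := by
  apply eq_of_mul_idem_eq
  intro χ
  have h : ∀ y : DrinfeldDouble k G, lamLin b (y * idem χ) = lamLin b y * idem χ := fun y => by
    rw [lamLin_map_mul, lamLin_idem]
  rw [lamLin_mul_idem, ← h, lamLin_mul_idem, h, lamLin_mul_idem, MonoidHom.mul_apply, shift_mul]

theorem lamLin_one (x : DrinfeldDouble k G) : lamLin 1 x = x := by
  simp only [lamLin_apply, MonoidHom.one_apply, shift_one, ← Finset.mul_sum, sum_idem, mul_one]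

/-- `toDual` sees only the component of the trivial character, and there the translation is by `b 1
= 1`. -/
theorem toDual_lamLin (b : CenterDual k G →* Subgroup.center G) (x : DrinfeldDouble k G) :
    toDual (lamLin b x) = toDual x := by
  classical
  rw [lamLin_apply, map_sum]
  simp only [toDual_mul_idem, counit_idem]
  simp [shift_one]

/-- Multiplicativity of `b` enters here: on the summand `idem χ₁ ⊗ idem (χ₁⁻¹ * χ)` of the coproduct
of `idem χ`, the translations by `b χ₁` and `b (χ₁⁻¹ * χ)` have to combine to the one by `b χ`. -/
theorem comul_lamLin (b : CenterDual k G →* Subgroup.center G) (x : DrinfeldDouble k G) :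
    TensorProduct.map (lamLin b) (lamLin b) (CoalgebraStruct.comul (R := k) x) =
      CoalgebraStruct.comul (R := k) (lamLin b x) := by
  have expand : ∀ t : DrinfeldDouble k G ⊗[k] DrinfeldDouble k G,
      TensorProduct.map (lamLin b) (lamLin b) t = ∑ χ : CenterDual k G, ∑ χ₁ : CenterDual k G,
        TensorProduct.map (shift (b χ₁)) (shift (b (χ₁⁻¹ * χ))) t *
          (idem χ₁ ⊗ₜ[k] idem (χ₁⁻¹ * χ)) := by
    intro t
    induction t with
    | zero => simp
    | add s t hs ht => simp only [map_add, hs, ht, add_mul, Finset.sum_add_distrib]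
    | tmul y z =>
      rw [TensorProduct.map_tmul, lamLin_apply, lamLin_apply, TensorProduct.sum_tmul]
      conv_rhs => rw [Finset.sum_comm]
      refine Finset.sum_congr rfl fun χ₁ _ => ?_
      rw [TensorProduct.tmul_sum]
      refine Fintype.sum_equiv (Equiv.mulLeft χ₁) _ _ fun χ₂ => ?_
      rw [Equiv.coe_mulLeft, inv_mul_cancel_left (G := CenterDual k G), TensorProduct.map_tmul,
        Algebra.TensorProduct.tmul_mul_tmul]
  rw [expand, lamLin_apply, map_sum]
  refine Finset.sum_congr rfl fun χ _ => ?_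
  rw [Bialgebra.comul_mul, comul_idem, Finset.mul_sum]
  refine Finset.sum_congr rfl fun χ₁ _ => ?_
  rw [← comul_shift, ← map_mul, mul_inv_cancel_left (G := CenterDual k G)]

/-- The bialgebra map which translates by `b(χ)` on the component of the character `χ`. -/
noncomputable def lamHom (b : CenterDual k G →* Subgroup.center G) :
    DrinfeldDouble k G →ₐc[k] DrinfeldDouble k G :=
  bialgHomOfBasis (lamLin b)
    (lamLin_smash_one b 1)
    (fun _ _ _ _ => lamLin_map_mul b _ _)
    (fun _ _ => by rw [counit_eq_toDual, counit_eq_toDual, toDual_lamLin])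
    (fun _ _ => comul_lamLin b _)

/-- The homomorphism to `Aut(D(G))` from the group of homomorphisms from the dual of the center to
the center. -/
noncomputable def lamAut : (CenterDual k G →* Subgroup.center G) →*
    (DrinfeldDouble k G ≃ₐc[k] DrinfeldDouble k G) :=
  autOfHom lamHom lamLin_one lamLin_comp

theorem lamAut_mul_idem (b : CenterDual k G →* Subgroup.center G) (x : DrinfeldDouble k G)
    (χ : CenterDual k G) : lamAut b x * idem χ = shift (b χ) x * idem χ :=
  lamLin_mul_idem b x χ

theorem lamAut_mem (b : CenterDual k G →* Subgroup.center G) : lamAut b ∈ Lam k G :=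
  (isLambda_iff _).mpr ⟨toDual_lamLin b, lamLin_smash_one b⟩

/-- Tested on `e_1 # 1`: its `χ`-component is moved to `(b χ)⁻¹`, and the coefficient at `(1, 1)`
survives only if `b χ = 1`. -/
theorem lamAut_injective : Function.Injective (lamAut : (CenterDual k G →* Subgroup.center G) →*
    (DrinfeldDouble k G ≃ₐc[k] DrinfeldDouble k G)) := by
  rw [injective_iff_map_eq_one]
  intro b hb
  ext χ
  have h := lamAut_mul_idem b (e 1 1) χ
  rw [hb, aut_one_apply, shift_e, one_mul] at h
  have coeff : ∀ g : G, coord (1, 1) (e g 1 * idem χ : DrinfeldDouble k G) =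
      if g = 1 then (Fintype.card (Subgroup.center G) : k)⁻¹ else 0 := by
    intro g
    simp only [idem, mul_smul_comm, Finset.mul_sum, map_smul, map_sum, e_mul_smash_one, one_mul,
      coord_apply, e_app]
    rw [Finset.sum_eq_single 1]
    · simp [eq_comm]
    · intro z _ hz
      rw [if_neg (fun h => hz (Subtype.ext h.symm)), smul_zero]
    · simp
  have h' := congrArg (coord (1, 1)) h
  have hc := card_center_ne_zero (k := k) (G := G)
  rw [coeff, coeff, if_pos rfl] at h'
  by_contra hne
  rw [if_neg (by simpa using hne)] at h'
  exact inv_ne_zero hc h'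

/-- Conjugation by `Aut(G)` on the automorphisms `(p, id, 1, id)`. -/
theorem mapAut_lamAut (v : MulAut G) (b b' : CenterDual k G →* Subgroup.center G)
    (h : ∀ χ, b' χ = centerRestrict v (b (χ.comp (centerRestrict v)))) (x : DrinfeldDouble k G) :
    mapAut v (lamAut b x) = lamAut b' (mapAut v x) := by
  apply eq_of_mul_idem_eq
  intro χ
  rw [lamAut_mul_idem, h, ← mapAut_shift, ← mapAut_idem, ← map_mul, ← map_mul, lamAut_mul_idem]

end DrinfeldDouble

namespace DrinfeldDouble

variable {k G : Type*} [Field k] [Group G] [Fintype G] [DecidableEq G]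

/-! ### Automorphisms in coordinates -/

/-- The product of coordinate functionals in the dual algebra; the order `a' * a` reflects the
co-opposite coproduct on `k^G`. -/
theorem coord_comul (a x a' x' : G) (y : DrinfeldDouble k G) :
    TensorProduct.lid k k (TensorProduct.map (coord (a, x)) (coord (a', x'))
      (CoalgebraStruct.comul (R := k) y)) = if x = x' then y (a' * a, x) else 0 := by
  have : (TensorProduct.lid k k).toLinearMap ∘ₗ
      TensorProduct.map (coord (a, x)) (coord (a', x')) ∘ₗ CoalgebraStruct.comul (R := k) =
        if x = x' then (coord (a' * a, x) : DrinfeldDouble k G →ₗ[k] k) else 0 := by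
    apply hom_ext
    intro g h
    simp only [LinearMap.comp_apply, comul_e, map_sum, TensorProduct.map_tmul, coord_apply,
      LinearEquiv.coe_coe, TensorProduct.lid_tmul, smul_eq_mul, e_app]
    rw [Finset.sum_eq_single a']
    · by_cases hx : x = x'
      · subst hx
        simp only [if_true, coord_apply, e_app, eq_inv_mul_iff_mul_eq]
        split_ifs <;> simp
      · simp only [if_neg hx, LinearMap.zero_apply]
        by_cases h1 : x = h
        · simp [h1 ▸ Ne.symm hx]
        · simp [h1]
    · intro c _ hc
      simp [Ne.symm hc]
    · simp
  have h := LinearMap.congr_fun this y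
  split_ifs at h ⊢ <;> exact h

theorem sum_apply_mul_apply (ψ : DrinfeldDouble k G ≃ₐc[k] DrinfeldDouble k G)
    (g h a x a' x' : G) :
    ∑ c, ψ (e (c⁻¹ * g) h) (a, x) * ψ (e c h) (a', x') =
      if x = x' then ψ (e g h) (a' * a, x) else 0 := by
  rw [← coord_comul, ← CoalgHomClass.map_comp_comul_apply, comul_e]
  simp [coord_apply]

theorem toDual_apply (x : DrinfeldDouble k G) (a : G) : toDual x a = ∑ h, x (a, h) := by
  have : LinearMap.proj a ∘ₗ (toDual : DrinfeldDouble k G →ₗ[k] _) = ∑ h, coord (a, h) :=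
    hom_ext fun g x => by
      simp [toDual_e, coord_apply, e_app, Pi.single_apply]
  have h := LinearMap.congr_fun this x
  simpa [coord_apply] using h

/-! ### The component `p` of an element of `Λ(G)` is supported on the center -/

section Lam

variable {ψ : DrinfeldDouble k G ≃ₐc[k] DrinfeldDouble k G} (hψ : ψ ∈ Lam k G)
include hψ

theorem toDual_of_mem_Lam (x : DrinfeldDouble k G) : toDual (ψ x) = toDual x :=
  ((isLambda_iff ψ).mp hψ).1 x

theorem smash_one_of_mem_Lam (g : G) : ψ (smash 1 g) = smash 1 g :=
  ((isLambda_iff ψ).mp hψ).2 g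

/-- Summing the coproduct identity over `x'` turns its second factor into the component `u`, which
is the identity, so only `c = a` contributes. Every coefficient is thereby one of `p`. The mirror
argument follows; comparing the two yields conjugation invariance of `p`. -/
theorem apply_eq_left_of_mem_Lam (g a x : G) :
    ψ (e g 1) (a, x) = ψ (e (a⁻¹ * g) 1) (1, x) := by
  have h : ∑ x', ∑ c, ψ (e (c⁻¹ * g) 1) (1, x) * ψ (e c 1) (a, x') = ψ (e g 1) (a, x) := by
    simp [sum_apply_mul_apply]
  rw [← h, Finset.sum_comm]
  simp [← Finset.mul_sum, ← toDual_apply, toDual_of_mem_Lam hψ, toDual_e, Pi.single_apply]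

theorem apply_eq_right_of_mem_Lam (g a x : G) :
    ψ (e g 1) (a, x) = ψ (e (g * a⁻¹) 1) (1, x) := by
  have h : ∑ x', ∑ c, ψ (e (c⁻¹ * g) 1) (a, x') * ψ (e c 1) (1, x) = ψ (e g 1) (a, x) := by
    simp [sum_apply_mul_apply]
  rw [← h, Finset.sum_comm]
  simp only [← Finset.sum_mul, ← toDual_apply, toDual_of_mem_Lam hψ, toDual_e, Pi.single_apply]
  rw [Finset.sum_eq_single (g * a⁻¹)]
  · simp
  · intro c _ hc
    rw [if_neg, zero_mul]
    rintro rfl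
    simp at hc
  · simp

theorem apply_eq_zero_of_mem_Lam {s : G} (hs : s ∉ Subgroup.center G) (g : G) :
    ψ (e g 1) (1, s) = 0 := by
  obtain ⟨a, ha⟩ : ∃ a, s⁻¹ * a * s ≠ a := by
    by_contra! h
    refine hs (Subgroup.mem_center_iff.mpr fun a => ?_)
    have := h a
    rwa [mul_assoc, inv_mul_eq_iff_eq_mul] at this
  -- The coefficients of `p(e_t)` over the coset of `s` modulo the centralizer of `a` add up to
  -- zero: this is the value at `a` of `toDual` of a product of two images, which vanishes because
  -- `s⁻¹ * a * s ≠ a`.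
  have hsum : ∀ t : G, ∑ r, ψ (e t 1) (1, r) * (if s⁻¹ * a * s = r⁻¹ * a * r then 1 else 0) =
      0 := by
    intro t
    have h1 : ψ (e (a * t) 1) * ψ (e (s⁻¹ * a * s) 1) =
        if a * t = s⁻¹ * a * s then ψ (e (a * t) 1) else 0 := by
      rw [← map_mul, e_mul_e]
      simp only [one_mul, mul_one, inv_one]
      split_ifs <;> simp
    have h2 : ∑ x, (ψ (e (a * t) 1) * ψ (e (s⁻¹ * a * s) 1)) (a, x) = 0 := by
      rw [h1, ← toDual_apply]
      split_ifs with hat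
      · rw [toDual_of_mem_Lam hψ, toDual_e, hat, Pi.single_apply, if_neg (Ne.symm ha)]
      · simp
    simp only [mul_app] at h2
    rw [Finset.sum_comm] at h2
    refine (Finset.sum_congr rfl fun r _ => ?_).trans h2
    rw [← Finset.mul_sum, apply_eq_left_of_mem_Lam hψ (a * t) a r, inv_mul_cancel_left]
    congr 1
    have h3 : ∑ x, ψ (e (s⁻¹ * a * s) 1) (r⁻¹ * a * r, r⁻¹ * x) =
        toDual (ψ (e (s⁻¹ * a * s) 1)) (r⁻¹ * a * r) := by
      rw [toDual_apply]
      exact Fintype.sum_equiv (Equiv.mulLeft r⁻¹) _ _ fun _ => rfl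
    rw [h3, toDual_of_mem_Lam hψ, toDual_e, Pi.single_apply]
    simp only [eq_comm]
  -- The coproduct identity isolates the term `r = s` of that coset sum; exchanging the sums then
  -- lets `hsum` annihilate everything.
  have h : ∑ r, (∑ c, ψ (e (c⁻¹ * g) 1) (1, s) * ψ (e c 1) (1, r)) *
      (if s⁻¹ * a * s = r⁻¹ * a * r then 1 else 0) = ψ (e g 1) (1, s) := by
    simp only [sum_apply_mul_apply]
    rw [Finset.sum_eq_single s]
    · simp
    · intro r _ hr
      simp [Ne.symm hr]
    · simp
  rw [← h]
  simp only [Finset.sum_mul]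
  rw [Finset.sum_comm]
  refine Finset.sum_eq_zero fun c _ => ?_
  refine Eq.trans ?_
    ((congrArg (ψ (e (c⁻¹ * g) 1) (1, s) * ·) (hsum c)).trans (mul_zero _))
  simp only [Finset.mul_sum, mul_assoc]

end Lam

theorem sum_eq_sum_center {M : Type*} [AddCommMonoid M] {f : G → M} (hf : ∀ x, x ∉ Subgroup.center G → f x = 0) :
    ∑ x, f x = ∑ z : Subgroup.center G, f z := by
  have h := Fintype.sum_subtype_add_sum_subtype (· ∈ Subgroup.center G) f
  rw [← h, Finset.sum_eq_zero (s := Finset.univ (α := {x // x ∉ Subgroup.center G}))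
    fun x _ => hf x x.2, add_zero]

/-- The coefficient at `g` of the composite of the algebra map `χ` with the component `p` of
`ψ`. -/
noncomputable def charCoeff (ψ : DrinfeldDouble k G ≃ₐc[k] DrinfeldDouble k G)
    (χ : CenterDual k G) (g : G) : k :=
  ∑ z : Subgroup.center G, (χ z : k) * ψ (e g 1) (1, (z : G))

/-! ### Every element of `Λ(G)` comes from a homomorphism of the dual of the center to the center -/

section Lam

variable {ψ : DrinfeldDouble k G ≃ₐc[k] DrinfeldDouble k G} (hψ : ψ ∈ Lam k G)
include hψ

/-- `χ ∘ p` is an algebra map, so it sends the orthogonal idempotents `e_g` to orthogonal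
idempotents of `k`. -/
theorem charCoeff_mul_charCoeff (χ : CenterDual k G) (g h : G) :
    charCoeff ψ χ g * charCoeff ψ χ h = if g = h then charCoeff ψ χ g else 0 := by
  have h1 : ψ (e g 1) * ψ (e h 1) = if g = h then ψ (e g 1) else 0 := by
    rw [← map_mul, e_mul_e]
    simp only [one_mul, mul_one, inv_one]
    split_ifs <;> simp
  have h2 : ∀ z : Subgroup.center G, ∑ s : Subgroup.center G,
      ψ (e g 1) (1, (s : G)) * ψ (e h 1) (1, ((s⁻¹ * z : Subgroup.center G) : G)) =
        if g = h then ψ (e g 1) (1, (z : G)) else 0 := by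
    intro z
    have h3 := congrArg (coord (1, (z : G))) h1
    -- At first coordinate `1` conjugation does nothing, so the product is convolution in the group
    -- algebra, and only central `s` contribute.
    rw [coord_apply, mul_app, sum_eq_sum_center] at h3
    · simp only [mul_one, inv_mul_cancel] at h3
      simp only [Subgroup.coe_mul, Subgroup.coe_inv]
      rw [h3]
      split_ifs
      · rfl
      · exact map_zero _
    · intro s hs
      rw [apply_eq_zero_of_mem_Lam hψ hs, zero_mul]
  have h4 : (if g = h then charCoeff ψ χ g else 0) =
      ∑ z : Subgroup.center G, (χ z : k) * if g = h then ψ (e g 1) (1, (z : G)) else 0 := by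
    split_ifs <;> simp [charCoeff]
  rw [h4]
  simp only [← h2, Finset.mul_sum]
  rw [Finset.sum_comm, charCoeff, Finset.sum_mul]
  refine Finset.sum_congr rfl fun s _ => ?_
  rw [charCoeff, Finset.mul_sum]
  refine Fintype.sum_equiv (Equiv.mulLeft s) _ _ fun w => ?_
  simp only [Equiv.coe_mulLeft, map_mul, Units.val_mul, inv_mul_cancel_left]
  ring

omit hψ in
theorem sum_charCoeff (χ : CenterDual k G) : ∑ g, charCoeff ψ χ g = 1 := by
  have h : ∑ g, ψ (e g 1) = 1 := by
    rw [← map_sum, ← one_eq_sum, map_one]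
  have h1 : ∀ x, ∑ g, ψ (e g 1) (1, x) = if x = 1 then 1 else 0 := by
    intro x
    have := congrArg (coord (1, x)) h
    rw [map_sum] at this
    refine this.trans ?_
    rw [coord_apply, one_def, smash_app, Pi.one_apply]
  simp only [charCoeff]
  rw [Finset.sum_comm]
  simp only [← Finset.mul_sum, h1]
  rw [Finset.sum_eq_single 1]
  · simp
  · intro z _ hz
    rw [if_neg (by simpa using hz), mul_zero]
  · simp

/-- Orthogonal idempotents of a field with sum `1`: exactly one of them is `1`. -/
theorem exists_charCoeff_eq (χ : CenterDual k G) :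
    ∃ b, ∀ g, charCoeff ψ χ g = if g = b then 1 else 0 := by
  obtain ⟨b, -, hb⟩ : ∃ b ∈ Finset.univ, charCoeff ψ χ b ≠ 0 := by
    apply Finset.exists_ne_zero_of_sum_ne_zero
    rw [sum_charCoeff]
    exact one_ne_zero
  refine ⟨b, fun g => ?_⟩
  have h := charCoeff_mul_charCoeff hψ χ g b
  split_ifs at h ⊢ with hg
  · rw [hg] at h ⊢
    exact mul_right_cancel₀ hb (h.trans (one_mul _).symm)
  · exact (mul_eq_zero.mp h).resolve_right hb

theorem charCoeff_mul_comm (χ : CenterDual k G) (a g : G) :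
    charCoeff ψ χ (a * g) = charCoeff ψ χ (g * a) := by
  refine Finset.sum_congr rfl fun z _ => ?_
  rw [← inv_inv a, ← apply_eq_left_of_mem_Lam hψ, ← apply_eq_right_of_mem_Lam hψ]

omit hψ in
-- `p` respects coproducts, so characters multiply by convolution; this makes the evaluation point
-- multiplicative in `χ`.
theorem charCoeff_mul (χ χ' : CenterDual k G) (g : G) :
    charCoeff ψ (χ * χ') g = ∑ c, charCoeff ψ χ (c⁻¹ * g) * charCoeff ψ χ' c := by
  simp only [charCoeff, Finset.sum_mul_sum]
  rw [Finset.sum_comm]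
  refine Finset.sum_congr rfl fun z _ => ?_
  rw [Finset.sum_comm]
  have h : ∀ w : Subgroup.center G, ∑ c, (χ z : k) * ψ (e (c⁻¹ * g) 1) (1, (z : G)) *
      ((χ' w : k) * ψ (e c 1) (1, (w : G))) =
        (χ z : k) * (χ' w : k) * if (z : G) = w then ψ (e g 1) (1, (z : G)) else 0 := by
    intro w
    have := sum_apply_mul_apply ψ g 1 1 z 1 w
    rw [mul_one] at this
    rw [← this, Finset.mul_sum]
    exact Finset.sum_congr rfl fun c _ => by ring
  simp only [h]
  rw [Finset.sum_eq_single z]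
  · simp [mul_assoc]
  · intro w _ hw
    rw [if_neg (fun h => hw (Subtype.ext h.symm)), mul_zero]
  · simp

variable [IsAlgClosed k] [CharZero k]

/-- The group part of `ψ (e g 1)` is central, hence acts on `idem χ` through the scalars `χ z`,
which assemble into `charCoeff`. -/
theorem apply_e_mul_idem (χ : CenterDual k G) (g : G) :
    ψ (e g 1) * idem χ = ∑ a, charCoeff ψ χ (a⁻¹ * g) • (e a 1 * idem χ) := by
  have h : ψ (e g 1) = ∑ a, ∑ z : Subgroup.center G,
      ψ (e (a⁻¹ * g) 1) (1, (z : G)) • (e a 1 * smash 1 (z : G)) := by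
    conv_lhs => rw [← basis.sum_repr (ψ (e g 1)), Fintype.sum_prod_type]
    refine Finset.sum_congr rfl fun a _ => ?_
    have : ∀ x, basis.repr (ψ (e g 1)) (a, x) • (basis (a, x) : DrinfeldDouble k G) =
        ψ (e (a⁻¹ * g) 1) (1, x) • (e a 1 * smash 1 x) := by
      intro x
      rw [e_mul_smash_one, one_mul, ← apply_eq_left_of_mem_Lam hψ, basis_app]
      rfl
    simp only [this]
    exact sum_eq_sum_center fun x hx => by rw [apply_eq_zero_of_mem_Lam hψ hx, zero_smul]
  rw [h, Finset.sum_mul]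
  refine Finset.sum_congr rfl fun a _ => ?_
  rw [Finset.sum_mul, charCoeff, Finset.sum_smul]
  refine Finset.sum_congr rfl fun z _ => ?_
  rw [smul_mul_assoc, mul_assoc, smash_one_mul_idem, mul_smul_comm, smul_smul, mul_comm]

theorem exists_lamAut_eq : ∃ b, lamAut b = ψ := by
  choose b hb using exists_charCoeff_eq hψ
  have hval : ∀ χ g, charCoeff ψ χ g = 1 → g = b χ := by
    intro χ g h
    rw [hb] at h
    by_contra hg
    rw [if_neg hg] at h
    exact zero_ne_one h
  have hcenter : ∀ χ, b χ ∈ Subgroup.center G := by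
    intro χ
    refine Subgroup.mem_center_iff.mpr fun a => ?_
    -- `charCoeff` is a class function equal to `1` only at `b χ`, so `b χ` is its own only
    -- conjugate.
    have := hval χ (a * b χ * a⁻¹) (by
      rw [mul_assoc, charCoeff_mul_comm hψ, inv_mul_cancel_right, hb, if_pos rfl])
    rwa [mul_inv_eq_iff_eq_mul] at this
  have hmul : ∀ χ χ', b (χ * χ') = b χ * b χ' := by
    intro χ χ'
    refine (hval _ _ ?_).symm
    rw [charCoeff_mul, Finset.sum_eq_single (b χ')]
    · rw [hb, hb, if_pos rfl, if_pos, mul_one]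
      rw [Subgroup.mem_center_iff.mp (hcenter χ'), inv_mul_cancel_left]
    · intro c _ hc
      rw [hb χ', if_neg hc, mul_zero]
    · simp
  refine ⟨MonoidHom.mk' (fun χ => ⟨b χ, hcenter χ⟩) fun χ χ' => Subtype.ext (hmul χ χ'), ?_⟩
  apply aut_ext
  intro g h
  apply eq_of_mul_idem_eq
  intro χ
  -- Factor `e_g # h` as `(e_g # 1)(1 # h)`; both maps fix `1 # h`, so only `e_g # 1` has to be
  -- compared.
  rw [lamAut_mul_idem, ← one_mul h, ← e_mul_smash_one, shift_map_mul, map_mul,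
    smash_one_of_mem_Lam hψ, shift_smash_one, mul_assoc, mul_assoc, ← idem_mul, ← mul_assoc,
    ← mul_assoc, apply_e_mul_idem hψ]
  congr 1
  rw [Finset.sum_eq_single (g * (b χ)⁻¹)]
  · rw [hb, if_pos (by group), one_smul, shift_e]
    rfl
  · intro a _ ha
    rw [hb, if_neg, zero_smul]
    intro h
    rw [← h] at ha
    apply ha
    group
  · simp

end Lam

end DrinfeldDouble

/-- Only the values are asked to commute, so that this applies to the noncommutative unit group of
`kG` as well as to `kˣ`. -/
theorem MonoidHom.eq_one_of_isPerfect {G H : Type*} [Group G] [Group H] (hG : Group.IsPerfect G)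
    (f : G →* H) (hf : ∀ x y, Commute (f x) (f y)) : f = 1 := by
  have : commutator G ≤ f.ker := by
    rw [commutator_def, Subgroup.commutator_le]
    intro x _ y _
    rw [MonoidHom.mem_ker, map_commutatorElement, commutatorElement_eq_one_iff_commute]
    exact hf x y
  ext g
  exact this (hG.commutator_eq_top ▸ Subgroup.mem_top g)

namespace DrinfeldDouble

variable {k G : Type*} [Field k] [Group G] [Fintype G] [DecidableEq G]

/-! ### Automorphisms of the double of a perfect group -/

/-- The image is group-like. The coproduct identity concentrates its support on one `h`, where its
coefficients form a linear character of `G`, trivial by perfectness. -/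
theorem exists_apply_smash_one_eq (hG : Group.IsPerfect G)
    (ψ : DrinfeldDouble k G ≃ₐc[k] DrinfeldDouble k G) (g : G) :
    ∃ h, ψ (smash 1 g) = smash 1 h := by
  have hmul : ∀ a x a' x', ψ (smash 1 g) (a, x) * ψ (smash 1 g) (a', x') =
      if x = x' then ψ (smash 1 g) (a' * a, x) else 0 := by
    intro a x a' x'
    rw [← coord_comul, ← CoalgHomClass.map_comp_comul_apply, comul_smash_one]
    simp [coord_apply]
  have hcounit : ∑ x, ψ (smash 1 g) (1, x) = 1 := by
    rw [← toDual_apply, ← counit_eq_toDual, CoalgHomClass.counit_comp_apply, counit_smash_one]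
  obtain ⟨h, -, hh⟩ : ∃ h ∈ Finset.univ, ψ (smash 1 g) (1, h) ≠ 0 := by
    apply Finset.exists_ne_zero_of_sum_ne_zero
    rw [hcounit]
    exact one_ne_zero
  refine ⟨h, ?_⟩
  have hone : ψ (smash 1 g) (1, h) = 1 := by
    have := hmul 1 h 1 h
    rw [if_pos rfl, mul_one] at this
    exact mul_right_cancel₀ hh (this.trans (one_mul _).symm)
  let f : G →* k :=
    { toFun := fun a => ψ (smash 1 g) (a, h)
      map_one' := hone
      map_mul' := fun a b => by rw [mul_comm, hmul, if_pos rfl] }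
  have hf : f.toHomUnits = 1 :=
    MonoidHom.eq_one_of_isPerfect hG _ fun x y => mul_comm _ _
  apply ext'
  rintro ⟨a, x⟩
  rw [smash_app]
  split_ifs with hx
  · have := congrArg Units.val (DFunLike.congr_fun hf a)
    simp only [] at hx
    rw [hx]
    exact this
  · have := hmul 1 h a x
    rw [if_neg (Ne.symm hx), hone, one_mul] at this
    exact this

/-- An automorphism of the double of a perfect group restricts to an automorphism of the group. -/
theorem exists_mulAut (hG : Group.IsPerfect G)
    (ψ : DrinfeldDouble k G ≃ₐc[k] DrinfeldDouble k G) :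
    ∃ v : MulAut G, ∀ g, ψ (smash 1 g) = smash 1 (v g) := by
  have hinj : ∀ x y : G, (smash 1 x : DrinfeldDouble k G) = smash 1 y → x = y := by
    intro x y h
    have := congrArg (coord (1, x)) h
    rw [coord_apply, coord_apply, smash_app, smash_app, if_pos rfl] at this
    by_contra hne
    rw [if_neg hne] at this
    exact one_ne_zero this
  choose v hv using exists_apply_smash_one_eq hG ψ
  let f : G →* G := MonoidHom.mk' v fun x y => hinj _ _ (by
    rw [← hv, ← smash_one_mul_smash_one, map_mul, hv, hv, smash_one_mul_smash_one])
  have hf : Function.Injective f := fun x y hxy => by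
    apply hinj
    apply ψ.toEquiv.injective
    change ψ (smash 1 x) = ψ (smash 1 y)
    rw [hv, hv]
    exact congrArg _ hxy
  exact ⟨MulEquiv.ofBijective f (Finite.injective_iff_bijective.mp hf), hv⟩

/-! ### Automorphisms fixing every `1 # g` lie in `Λ(G)` when `G` is perfect -/

section Fixed

variable {ψ : DrinfeldDouble k G ≃ₐc[k] DrinfeldDouble k G}

/-- The transpose of the component `u` of `ψ`. -/
noncomputable def transposeU (ψ : DrinfeldDouble k G ≃ₐc[k] DrinfeldDouble k G) :
    G →* MonoidAlgebra k G where
  toFun a := ∑ c, toDual (ψ (e c 1)) a • MonoidAlgebra.of k G c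
  map_one' := by
    have h : ∀ c, toDual (ψ (e c 1)) 1 = if c = 1 then 1 else 0 := fun c => by
      rw [← counit_eq_toDual, CoalgHomClass.counit_comp_apply, counit_e]
    simp only [h, ite_smul, one_smul, zero_smul, Finset.sum_ite_eq', Finset.mem_univ, if_true,
      map_one]
  map_mul' a b := by
    have h : ∀ g, toDual (ψ (e g 1)) (a * b) =
        ∑ c, toDual (ψ (e (c⁻¹ * g) 1)) b * toDual (ψ (e c 1)) a := by
      intro g
      simp only [toDual_apply, Finset.sum_mul_sum]
      rw [Finset.sum_comm]
      refine Finset.sum_congr rfl fun x _ => ?_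
      rw [Finset.sum_comm]
      simp only [sum_apply_mul_apply]
      simp
    simp only [h, Finset.sum_smul, Finset.sum_mul_sum, smul_mul_smul_comm, ← map_mul]
    rw [Finset.sum_comm]
    refine Finset.sum_congr rfl fun c _ => ?_
    refine Fintype.sum_equiv (Equiv.mulLeft c⁻¹) _ _ fun g => ?_
    simp [mul_comm]

theorem transposeU_apply (ψ : DrinfeldDouble k G ≃ₐc[k] DrinfeldDouble k G) (a : G) :
    transposeU ψ a = ∑ c, toDual (ψ (e c 1)) a • MonoidAlgebra.of k G c := rfl

theorem transposeU_coeff (ψ : DrinfeldDouble k G ≃ₐc[k] DrinfeldDouble k G) (a c : G) :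
    (transposeU ψ a).coeff c = toDual (ψ (e c 1)) a := by
  simp [transposeU_apply, Finsupp.single_apply]

variable (h_fix : ∀ g, ψ (smash 1 g) = smash 1 g)
include h_fix

theorem toDual_apply_eq (x : DrinfeldDouble k G) :
    toDual (ψ x) = ∑ c, toDual x c • toDual (ψ (e c 1)) := by
  have : toDual ∘ₗ (ψ : DrinfeldDouble k G →ₗ[k] DrinfeldDouble k G) =
      ∑ c, LinearMap.smulRight (LinearMap.proj c ∘ₗ toDual) (toDual (ψ (e c 1))) := by
    apply hom_ext
    intro g h
    rw [LinearMap.comp_apply]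
    change toDual (ψ (e g h)) = _
    rw [← one_mul h, ← e_mul_smash_one, map_mul, h_fix, toDual_mul_smash_one]
    simp [toDual_mul_smash_one, toDual_e, Pi.single_apply]
  have h := LinearMap.congr_fun this x
  simpa using h

/-- `ψ` fixes `1 # h`, hence commutes with conjugation by it, which sends `e_c # 1` to `e_{h c h⁻¹}
# 1`. -/
theorem transposeU_conj (h a : G) :
    transposeU ψ (h * a * h⁻¹) =
      MonoidAlgebra.of k G h * transposeU ψ a * MonoidAlgebra.of k G h⁻¹ := by
  simp only [transposeU_apply, Finset.mul_sum, Finset.sum_mul, mul_smul_comm, smul_mul_assoc,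
    ← map_mul]
  symm
  refine Fintype.sum_equiv (MulAut.conj h).toEquiv _ _ fun c => ?_
  have : (e (h * c * h⁻¹) 1 : DrinfeldDouble k G) = smash 1 h * e c 1 * smash 1 h⁻¹ := by
    rw [smash_one_mul_e, e_mul_smash_one, mul_one, mul_inv_cancel]
  have hc : (MulAut.conj h).toEquiv c = h * c * h⁻¹ := rfl
  rw [hc, this, map_mul ψ, map_mul ψ, h_fix, h_fix, toDual_mul_smash_one, toDual_smash_one_mul]
  congr 2
  group

/-- Since `ψ` is onto, so is `u`; its transpose is therefore injective, and surjective by finite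
dimension. -/
theorem lift_transposeU_surjective :
    Function.Surjective (MonoidAlgebra.lift k (MonoidAlgebra k G) G (transposeU ψ)) := by
  have hinj : Function.Injective
      (MonoidAlgebra.lift k (MonoidAlgebra k G) G (transposeU ψ)).toLinearMap := by
    rw [← LinearMap.ker_eq_bot, LinearMap.ker_eq_bot']
    intro f hf
    have h1 : ∀ c, ∑ a, f.coeff a * toDual (ψ (e c 1)) a = 0 := by
      intro c
      have hsum : MonoidAlgebra.lift k (MonoidAlgebra k G) G (transposeU ψ) f =
          ∑ a, f.coeff a • transposeU ψ a := by
        rw [MonoidAlgebra.lift_apply]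
        exact Finsupp.sum_fintype _ _ fun _ => zero_smul _ _
      refine Eq.trans ?_ (congrArg (fun y : MonoidAlgebra k G => y.coeff c) (hsum.symm.trans hf))
      rw [MonoidAlgebra.coeff_sum, Finsupp.finsetSum_apply]
      refine Finset.sum_congr rfl fun a _ => ?_
      rw [MonoidAlgebra.coeff_smul_apply, transposeU_coeff, smul_eq_mul]
    have h2 : ∀ x : DrinfeldDouble k G, ∑ a, f.coeff a * toDual (ψ x) a = 0 := by
      intro x
      rw [toDual_apply_eq h_fix x]
      simp only [Finset.sum_apply, Pi.smul_apply, smul_eq_mul,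
        Finset.mul_sum]
      rw [Finset.sum_comm]
      refine Finset.sum_eq_zero fun c _ => ?_
      rw [← mul_zero (toDual x c), ← h1 c, Finset.mul_sum]
      exact Finset.sum_congr rfl fun a _ => by ring
    ext a
    have := h2 (ψ⁻¹ (e a 1))
    simpa [aut_apply_inv_apply, toDual_e, Pi.single_apply] using this
  exact LinearMap.injective_iff_surjective.mp hinj

/-- Conjugating `transposeU ψ a` by `h` or by `transposeU ψ h` has the same effect, so `h⁻¹ *
transposeU ψ h` commutes with the image of `transposeU ψ`, which spans `kG`. Being central, these
elements depend multiplicatively on `h`, and perfectness makes them trivial. -/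
theorem transposeU_eq_of (hG : Group.IsPerfect G) (a : G) :
    transposeU ψ a = MonoidAlgebra.of k G a := by
  have hconj : ∀ h a, transposeU ψ h * transposeU ψ a =
      MonoidAlgebra.of k G h * transposeU ψ a * MonoidAlgebra.of k G h⁻¹ * transposeU ψ h := by
    intro h a
    rw [← transposeU_conj h_fix, ← map_mul, ← map_mul]
    simp
  have hof : ∀ h, MonoidAlgebra.of k G h⁻¹ * MonoidAlgebra.of k G h = 1 := fun h => by
    rw [← map_mul, inv_mul_cancel, map_one]
  have hcentral : ∀ h (y : MonoidAlgebra k G),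
      Commute (MonoidAlgebra.of k G h⁻¹ * transposeU ψ h) y := by
    intro h y
    obtain ⟨x, rfl⟩ := lift_transposeU_surjective h_fix y
    induction x using MonoidAlgebra.induction_on with
    | of a =>
      rw [MonoidAlgebra.lift_of, Commute, SemiconjBy, mul_assoc, hconj]
      simp only [← mul_assoc, hof, one_mul]
    | add x y hx hy => rw [map_add]; exact hx.add_right hy
    | smul r x hx => rw [map_smul]; exact hx.smul_right r
  let f : G →* MonoidAlgebra k G :=
    { toFun := fun h => MonoidAlgebra.of k G h⁻¹ * transposeU ψ h
      map_one' := by rw [inv_one, map_one, map_one, one_mul]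
      map_mul' := fun x y => by
        rw [map_mul, mul_inv_rev, map_mul, (hcentral x _).eq, mul_assoc, mul_assoc,
          ← (hcentral x (transposeU ψ y)).eq, mul_assoc] }
  have hf : f.toHomUnits = 1 :=
    MonoidHom.eq_one_of_isPerfect hG _ fun x y => Units.ext (hcentral x _)
  have h1 : MonoidAlgebra.of k G a⁻¹ * transposeU ψ a = 1 :=
    congrArg Units.val (DFunLike.congr_fun hf a)
  have h2 := congrArg (MonoidAlgebra.of k G a * ·) h1
  simpa only [← mul_assoc, ← map_mul, mul_inv_cancel, map_one, one_mul, mul_one] using h2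

theorem mem_Lam_of_isPerfect (hG : Group.IsPerfect G) : ψ ∈ Lam k G := by
  refine (isLambda_iff ψ).mpr ⟨fun x => ?_, h_fix⟩
  have h : ∀ c, toDual (ψ (e c 1)) = Pi.single c 1 := by
    intro c
    ext a
    rw [← transposeU_coeff, transposeU_eq_of h_fix hG]
    simp [Pi.single_apply, Finsupp.single_apply]
  rw [toDual_apply_eq h_fix]
  ext a
  simp [h, Pi.single_apply]

end Fixed

theorem exists_mem_Lam_mul_mapAut (hG : Group.IsPerfect G)
    (ψ : DrinfeldDouble k G ≃ₐc[k] DrinfeldDouble k G) :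
    ∃ l ∈ Lam k G, ∃ v, ψ = l * mapAut v := by
  obtain ⟨v, hv⟩ := exists_mulAut hG ψ
  refine ⟨ψ * (mapAut v)⁻¹, mem_Lam_of_isPerfect (fun g => ?_) hG, v, by group⟩
  rw [← map_inv, aut_mul_apply, mapAut_smash_one, hv]
  simp

end DrinfeldDouble

/-- A homomorphism `f` into a group acts by conjugation on the subgroups normalized by its image. -/
def Subgroup.conjHom {H K : Type*} [Group H] [Group K] (N : Subgroup H) (f : K →* H)
    (h : ∀ v, ∀ n ∈ N, f v * n * (f v)⁻¹ ∈ N) : K →* MulAut N where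
  toFun v :=
    { toFun := fun n => ⟨f v * n * (f v)⁻¹, h v n n.2⟩
      invFun := fun n => ⟨(f v)⁻¹ * n * f v, by simpa using h v⁻¹ n n.2⟩
      left_inv := fun n => Subtype.ext (by simp [mul_assoc])
      right_inv := fun n => Subtype.ext (by simp [mul_assoc])
      map_mul' := fun l m => Subtype.ext (by simp [mul_assoc]) }
  map_one' := MulEquiv.ext fun n => Subtype.ext (by simp)
  map_mul' v w := MulEquiv.ext fun n => Subtype.ext (by simp [mul_assoc])

open scoped commutatorElement in
theorem IsSimpleGroup.isPerfect {G : Type*} [Group G] [IsSimpleGroup G]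
    (hG : ¬ ∀ a b : G, a * b = b * a) : Group.IsPerfect G := by
  refine ⟨(Subgroup.Normal.eq_bot_or_eq_top inferInstance).resolve_left fun h => hG fun a b => ?_⟩
  rw [← commutatorElement_eq_one_iff_mul_comm]
  have : ⁅a, b⁆ ∈ commutator G :=
    Subgroup.commutator_mem_commutator (Subgroup.mem_top a) (Subgroup.mem_top b)
  rwa [h, Subgroup.mem_bot] at this

theorem IsSimpleGroup.center_eq_bot {G : Type*} [Group G] [IsSimpleGroup G]
    (hG : ¬ ∀ a b : G, a * b = b * a) : Subgroup.center G = ⊥ :=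
  (Subgroup.Normal.eq_bot_or_eq_top inferInstance).resolve_right fun h => hG fun a b =>
    Subgroup.mem_center_iff.mp (h ▸ Subgroup.mem_top b) a

namespace DrinfeldDouble

variable {k G : Type*} [Field k] [Group G] [Fintype G] [DecidableEq G]

/-! ### The semidirect product decomposition -/

theorem conj_mapAut_mem_Lam (v : MulAut G) {l : DrinfeldDouble k G ≃ₐc[k] DrinfeldDouble k G}
    (hl : l ∈ Lam k G) : mapAut v * l * (mapAut v)⁻¹ ∈ Lam k G := by
  refine (isLambda_iff _).mpr ⟨fun x => ?_, fun g => ?_⟩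
  · rw [aut_mul_apply, aut_mul_apply, toDual_mapAut, toDual_of_mem_Lam hl, ← toDual_mapAut,
      aut_apply_inv_apply]
  · rw [← map_inv, aut_mul_apply, aut_mul_apply, mapAut_smash_one, smash_one_of_mem_Lam hl,
      mapAut_smash_one]
    simp

theorem eq_one_of_mapAut_mem_Lam {v : MulAut G}
    (h : (mapAut v : DrinfeldDouble k G ≃ₐc[k] DrinfeldDouble k G) ∈ Lam k G) : v = 1 := by
  refine MulEquiv.ext fun g => ?_
  change v g = g
  have h1 := toDual_of_mem_Lam h (e g 1)
  rw [mapAut_e, toDual_e, toDual_e] at h1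
  have h2 := congrFun h1 (v g)
  by_contra hne
  rw [Pi.single_eq_same, Pi.single_eq_of_ne hne] at h2
  exact one_ne_zero h2

variable (k) in
/-- The action of `Aut(G)` on `Λ(G)` by conjugation. -/
noncomputable def conjLam : MulAut G →* MulAut (Lam k G) :=
  (Lam k G).conjHom mapAut fun v _ => conj_mapAut_mem_Lam v

theorem coe_conjLam (v : MulAut G) (l : Lam k G) :
    (conjLam k v l : DrinfeldDouble k G ≃ₐc[k] DrinfeldDouble k G) =
      mapAut v * l.1 * (mapAut v)⁻¹ := rfl

theorem compP_conjLam (v : MulAut G) (l : Lam k G) :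
    compP (conjLam k v l : DrinfeldDouble k G ≃ₐc[k] DrinfeldDouble k G) =
      (MonoidAlgebra.mapDomainAlgHom k k (v : G →* G)).toLinearMap ∘ₗ
        compP (l : DrinfeldDouble k G ≃ₐc[k] DrinfeldDouble k G) ∘ₗ LinearMap.funLeft k k v := by
  refine LinearMap.ext fun a => ?_
  have h : mapAut v⁻¹ (smash a 1 : DrinfeldDouble k G) = smash (a ∘ v) 1 := by
    have := mapAut_smash v⁻¹ (a ∘ v : G → k) 1
    rw [map_one, Function.comp_assoc] at this
    rw [← this]
    congr 2
    ext g
    simp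
  change toGrp (mapAut v ((l : DrinfeldDouble k G ≃ₐc[k] DrinfeldDouble k G)
    ((mapAut v)⁻¹ (smash a 1)))) = _
  rw [toGrp_mapAut, ← map_inv, h]
  rfl

/-- The homomorphism `Λ(G) ⋊ Aut(G) → Aut(D(G))`. -/
noncomputable def semidirectHom : Lam k G ⋊[conjLam k] MulAut G →*
    (DrinfeldDouble k G ≃ₐc[k] DrinfeldDouble k G) :=
  SemidirectProduct.lift (Lam k G).subtype mapAut fun v => by
    ext1 l
    simp [coe_conjLam]

theorem semidirectHom_inl (l : Lam k G) : semidirectHom (SemidirectProduct.inl l) = l.1 := by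
  simp [semidirectHom]

theorem semidirectHom_inr (v : MulAut G) :
    semidirectHom (k := k) (SemidirectProduct.inr v) = mapAut v := by
  simp [semidirectHom]

theorem semidirectHom_injective :
    Function.Injective (semidirectHom : Lam k G ⋊[conjLam k] MulAut G →* _) := by
  rw [injective_iff_map_eq_one]
  rintro ⟨l, v⟩ h
  have h1 : (l : DrinfeldDouble k G ≃ₐc[k] DrinfeldDouble k G) * mapAut v = 1 := h
  have hv : v = 1 := eq_one_of_mapAut_mem_Lam (k := k) (by
    rw [eq_inv_of_mul_eq_one_right h1]
    exact inv_mem l.2)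
  subst hv
  rw [map_one, mul_one] at h1
  ext1
  · exact Subtype.ext h1
  · rfl

theorem semidirectHom_surjective (hG : Group.IsPerfect G) :
    Function.Surjective (semidirectHom : Lam k G ⋊[conjLam k] MulAut G →* _) := by
  intro ψ
  obtain ⟨l, hl, v, rfl⟩ := exists_mem_Lam_mul_mapAut hG ψ
  exact ⟨⟨⟨l, hl⟩, v⟩, rfl⟩

variable [IsAlgClosed k] [CharZero k]

/-- `Λ(G)` is isomorphic to the group of homomorphisms from the dual of the center to the
center. -/
noncomputable def lamEquiv : (CenterDual k G →* Subgroup.center G) ≃* Lam k G :=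
  MulEquiv.ofBijective (lamAut.codRestrict (Lam k G) lamAut_mem)
    ⟨fun _ _ h => lamAut_injective (congrArg Subtype.val h), fun l => by
      obtain ⟨b, hb⟩ := exists_lamAut_eq l.2
      exact ⟨b, Subtype.ext hb⟩⟩

theorem coe_lamEquiv (b : CenterDual k G →* Subgroup.center G) :
    (lamEquiv b : DrinfeldDouble k G ≃ₐc[k] DrinfeldDouble k G) = lamAut b := rfl

theorem conjLam_lamEquiv (v : MulAut G) (b : CenterDual k G →* Subgroup.center G) :
    conjLam k v (lamEquiv b) = lamEquiv ((centerRestrict v).comp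
      (b.comp (MonoidHom.compHom' (P := kˣ) (centerRestrict v)))) := by
  apply Subtype.ext
  rw [coe_conjLam, coe_lamEquiv, coe_lamEquiv]
  refine BialgEquiv.ext fun x => ?_
  rw [aut_mul_apply, aut_mul_apply, mapAut_lamAut v b ((centerRestrict v).comp
    (b.comp (MonoidHom.compHom' (P := kˣ) (centerRestrict v)))) fun _ => rfl, aut_apply_inv_apply]

/-- The isomorphism between `Λ(G)` and `End(Z(G))` given by an identification of the center with
its dual. -/
noncomputable def lamEquivEnd (θ : CenterDual k G ≃* Subgroup.center G) :
    Lam k G ≃* (Subgroup.center G →* Subgroup.center G) :=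
  lamEquiv.symm.trans θ.monoidHomCongrLeft

theorem lamEquivEnd_symm_apply (θ : CenterDual k G ≃* Subgroup.center G)
    (f : Subgroup.center G →* Subgroup.center G) :
    (lamEquivEnd θ).symm f = lamEquiv (f.comp θ.toMonoidHom) := rfl

theorem lamEquivEnd_lamEquiv (θ : CenterDual k G ≃* Subgroup.center G)
    (b : CenterDual k G →* Subgroup.center G) (z : Subgroup.center G) :
    lamEquivEnd θ (lamEquiv b) z = b (θ.symm z) := by
  simp [lamEquivEnd]

/-! ### When every automorphism comes from the group -/

/-- An abstract isomorphism `Φ` suffices: `Φ ∘ mapAut` is an injective self-map of the finite set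
`Aut(G)`. -/
theorem mapAut_surjective_of_nonempty
    (h : Nonempty ((DrinfeldDouble k G ≃ₐc[k] DrinfeldDouble k G) ≃* MulAut G)) :
    Function.Surjective
      (mapAut : MulAut G →* (DrinfeldDouble k G ≃ₐc[k] DrinfeldDouble k G)) := by
  obtain ⟨Φ⟩ := h
  have hsurj : Function.Surjective (Φ ∘ mapAut) :=
    Finite.surjective_of_injective (Φ.injective.comp mapAut_injective)
  exact (Function.Surjective.of_comp_iff' Φ.bijective _).mp hsurj

/-- `Λ(G)` meets the image of `mapAut` trivially, so every `b` is trivial, including an isomorphism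
of the dual of the center with the center. -/
theorem center_eq_bot_of_mapAut_surjective (h : Function.Surjective
    (mapAut : MulAut G →* (DrinfeldDouble k G ≃ₐc[k] DrinfeldDouble k G))) :
    Subgroup.center G = ⊥ := by
  obtain ⟨θ⟩ : Nonempty (CenterDual k G ≃* Subgroup.center G) :=
    CommGroup.monoidHom_mulEquiv_of_hasEnoughRootsOfUnity _ k
  have key : ∀ b : CenterDual k G →* Subgroup.center G, b = 1 := by
    intro b
    obtain ⟨v, hv⟩ := h (lamAut b)
    have hv1 : v = 1 := eq_one_of_mapAut_mem_Lam (k := k) (by rw [hv]; exact lamAut_mem _)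
    rw [hv1, map_one] at hv
    exact lamAut_injective (hv.symm.trans (map_one _).symm)
  rw [Subgroup.eq_bot_iff_forall]
  intro z hz
  have h1 := DFunLike.congr_fun (key θ.toMonoidHom) (θ.symm ⟨z, hz⟩)
  have h2 : (⟨z, hz⟩ : Subgroup.center G) = 1 := by
    rw [← θ.apply_symm_apply ⟨z, hz⟩]
    exact h1
  exact congrArg Subtype.val h2

theorem isPerfect_of_mapAut_surjective (h : Function.Surjective
    (mapAut : MulAut G →* (DrinfeldDouble k G ≃ₐc[k] DrinfeldDouble k G))) :
    Group.IsPerfect G := by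
  obtain ⟨η⟩ : Nonempty ((Abelianization G →* kˣ) ≃* Abelianization G) :=
    CommGroup.monoidHom_mulEquiv_of_hasEnoughRootsOfUnity _ k
  -- A bicharacter whose kernel is the commutator subgroup, built from the isomorphism of the
  -- abelianization with its dual; its triviality means perfectness.
  let r : G →* G →* kˣ := (MonoidHom.compHom' Abelianization.of).comp
    (η.symm.toMonoidHom.comp Abelianization.of)
  obtain ⟨v, hv⟩ := h (twistAut r)
  have hr : r = 1 := eq_one_of_twistAut_eq_mapAut hv.symm
  refine ⟨(Subgroup.eq_top_iff' _).mpr fun g => ?_⟩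
  rw [← Abelianization.ker_of, MonoidHom.mem_ker]
  have h1 : η.symm (Abelianization.of g) = 1 := by
    apply Abelianization.hom_ext
    exact DFunLike.congr_fun hr g
  exact (map_eq_one_iff _ η.symm.injective).mp h1

theorem nonempty_mulEquiv_mulAut (hZ : Subgroup.center G = ⊥) (hG : Group.IsPerfect G) :
    Nonempty ((DrinfeldDouble k G ≃ₐc[k] DrinfeldDouble k G) ≃* MulAut G) := by
  have hsurj : Function.Surjective
      (mapAut : MulAut G →* (DrinfeldDouble k G ≃ₐc[k] DrinfeldDouble k G)) := by
    intro ψ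
    obtain ⟨l, hl, v, rfl⟩ := exists_mem_Lam_mul_mapAut hG ψ
    obtain ⟨b, rfl⟩ := exists_lamAut_eq hl
    have hb : b = 1 := by
      ext χ
      exact (Subgroup.eq_bot_iff_forall _).mp hZ _ (b χ).2
    exact ⟨v, by rw [hb, map_one, one_mul]⟩
  exact ⟨(MulEquiv.ofBijective mapAut ⟨mapAut_injective, hsurj⟩).symm⟩

end DrinfeldDouble

theorem mainTheorem7 {k G : Type*} [Field k] [IsAlgClosed k] [CharZero k]
    [Group G] [Fintype G] [DecidableEq G] :
    -- perfect groups
    (Group.IsPerfect G →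
      -- `Aut(D(G)) = Λ(G) ⋊ Aut(G)`, the action being `v.(p, id, 1, id) = (v p v^*, id, 1, id)`
      ∃ φ : MulAut G →* MulAut (DrinfeldDouble.Lam k G),
        (∀ (v : MulAut G) (l : DrinfeldDouble.Lam k G),
          DrinfeldDouble.compP (φ v l : DrinfeldDouble k G ≃ₐc[k] DrinfeldDouble k G) =
            (MonoidAlgebra.mapDomainAlgHom k k (v : G →* G)).toLinearMap ∘ₗ
              DrinfeldDouble.compP (l : DrinfeldDouble k G ≃ₐc[k] DrinfeldDouble k G) ∘ₗ
              LinearMap.funLeft k k v) ∧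
        (∃ E : DrinfeldDouble.Lam k G ⋊[φ] MulAut G ≃*
            (DrinfeldDouble k G ≃ₐc[k] DrinfeldDouble k G),
          (∀ l : DrinfeldDouble.Lam k G, E (SemidirectProduct.inl l) = l) ∧
          ∀ (v : MulAut G) (g h : G), E (SemidirectProduct.inr v) (DrinfeldDouble.e g h) =
            DrinfeldDouble.e (v g) (v h)) ∧
        -- `Λ(G) ⋊ Aut(G) ≅ End(Z(G)) ⋊ Aut(G)`, where `Aut(G)` acts on `End(Z(G))` through an
        -- identification `θ` of `Z(G)` with its character group
        Nonempty ((Subgroup.center G →* kˣ) ≃* Subgroup.center G) ∧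
        ∀ θ : (Subgroup.center G →* kˣ) ≃* Subgroup.center G,
          ∃ φ' : MulAut G →* MulAut (Subgroup.center G →* Subgroup.center G),
            (∀ (v : MulAut G) (f : Subgroup.center G →* Subgroup.center G)
              (z : Subgroup.center G),
              φ' v f z = centerRestrict v (f (θ ((θ.symm z).comp (centerRestrict v))))) ∧
            (∃ F : DrinfeldDouble.Lam k G ≃* (Subgroup.center G →* Subgroup.center G),
              ∀ (v : MulAut G) (l : DrinfeldDouble.Lam k G), F (φ v l) = φ' v (F l)) ∧
            Nonempty ((DrinfeldDouble.Lam k G ⋊[φ] MulAut G) ≃*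
              ((Subgroup.center G →* Subgroup.center G) ⋊[φ'] MulAut G)) ∧
            Nonempty ((DrinfeldDouble k G ≃ₐc[k] DrinfeldDouble k G) ≃*
              ((Subgroup.center G →* Subgroup.center G) ⋊[φ'] MulAut G))) ∧
    -- the centerless perfect groups are exactly those with `Aut(D(G)) ≅ Aut(G)`
    (Nonempty ((DrinfeldDouble k G ≃ₐc[k] DrinfeldDouble k G) ≃* MulAut G) ↔
      Subgroup.center G = ⊥ ∧ Group.IsPerfect G) ∧
    -- non-abelian simple groups
    (IsSimpleGroup G → (¬ ∀ a b : G, a * b = b * a) →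
      Nonempty ((DrinfeldDouble k G ≃ₐc[k] DrinfeldDouble k G) ≃* MulAut G)) := by
  open DrinfeldDouble in
  have h2 : Nonempty ((DrinfeldDouble k G ≃ₐc[k] DrinfeldDouble k G) ≃* MulAut G) ↔
      Subgroup.center G = ⊥ ∧ Group.IsPerfect G :=
    ⟨fun h => ⟨center_eq_bot_of_mapAut_surjective (mapAut_surjective_of_nonempty h),
      isPerfect_of_mapAut_surjective (mapAut_surjective_of_nonempty h)⟩,
      fun h => nonempty_mulEquiv_mulAut h.1 h.2⟩
  open DrinfeldDouble in
  refine ⟨fun hG => ?_, h2, fun hS hab =>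
    h2.mpr ⟨IsSimpleGroup.center_eq_bot hab, IsSimpleGroup.isPerfect hab⟩⟩
  let E : Lam k G ⋊[conjLam k] MulAut G ≃* (DrinfeldDouble k G ≃ₐc[k] DrinfeldDouble k G) :=
    MulEquiv.ofBijective semidirectHom ⟨semidirectHom_injective, semidirectHom_surjective hG⟩
  refine ⟨conjLam k, compP_conjLam, ⟨E, fun l => ?_, fun v g h => ?_⟩,
    CommGroup.monoidHom_mulEquiv_of_hasEnoughRootsOfUnity _ k, fun θ => ?_⟩
  · exact semidirectHom_inl l
  · have : E (SemidirectProduct.inr v) = mapAut v := semidirectHom_inr v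
    rw [this, mapAut_e]
  -- The action is conjugation transported along `lamEquivEnd θ`, which makes equivariance automatic
  -- and leaves only the explicit formula to verify.
  · let φ' : MulAut G →* MulAut (Subgroup.center G →* Subgroup.center G) :=
      (MulAut.congr (lamEquivEnd θ)).toMonoidHom.comp (conjLam k)
    have hF : ∀ (v : MulAut G) (l : Lam k G),
        lamEquivEnd θ (conjLam k v l) = φ' v (lamEquivEnd θ l) := fun v l => by
      simp [φ']
    let C : Lam k G ⋊[conjLam k] MulAut G ≃*
        (Subgroup.center G →* Subgroup.center G) ⋊[φ'] MulAut G :=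
      SemidirectProduct.congr (lamEquivEnd θ) (MulEquiv.refl _)
        fun v => MulEquiv.ext fun l => hF v l
    refine ⟨φ', fun v f z => ?_, ⟨lamEquivEnd θ, hF⟩, ⟨C⟩, ⟨E.symm.trans C⟩⟩
    have : φ' v f = lamEquivEnd θ (conjLam k v ((lamEquivEnd θ).symm f)) := rfl
    rw [this, lamEquivEnd_symm_apply, conjLam_lamEquiv, lamEquivEnd_lamEquiv]
    rfl
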